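/- A graph is a *threshold graph* if there are real vertex weights $w_i$ and a real $t$ such that distinct vertices $i,j$ are adjacent if and only if $w_i+w_j>t$. For each $n\ge 1$ let $T_n$ be a uniformly random unlabeled threshold graph with $n$ vertices (an isomorphism class), and let $T^L_n$ be a uniformly random labeled threshold graph with vertex set $\{1,\dots,n\}$. For a graph $G$ with $v(G)\ge 1$ vertices, let $\nu(G)=\frac1{v(G)}\sum_{v}\delta_{d_G(v)/v(G)}$ be its normalized degree distribution, an element of the space $\mathcal P$ of probability measures on $[0,1]$ with the weak topology, and let $t(F,G)$ be the probability that a uniformly random map $V(F)\to V(G)$ is a graph homomorphism. Let $\overline{\mathcal U}$ be the compactification of the set $\mathcal U$ of unlabeled graphs with at least one vertex obtained as the closure of the image of $G\mapsto\big((t(F,G))_F,\,1/v(G)\big)$ in the product topology, where $F$ ranges over all finite graphs, and let $\mathcal U_\infty=\overline{\mathcal U}\setminus\mathcal U$ be the set of graph limits; thus $G_n\to\Gamma\in\mathcal U_\infty$ if and only if $v(G_n)\to\infty$ and $t(F,G_n)\to t(F,\Gamma)$ for every $F$. Let $\lambda\in\mathcal P$ be the uniform distribution on $[0,1]$. For $\mu\in\mathcal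 P$ let $W_\mu$ be the indicator function of $S_\mu=\{(x,y)\in[0,1]^2: x\ge\mu([0,1-y))\}$; thus $W_\lambda(x,y)=\mathbf 1\{x+y\ge1\}$. When $W_\mu$ is symmetric (as it is for $\mu=\lambda$), let $\Gamma_\mu$ be the point defined by $$t(F,\Gamma_\mu)=\int_{[0,1]^{v(F)}}\prod_{ij\in E(F)}W_\mu(x_i,x_j)\,dx_1\cdots dx_{v(F)}$$ for every finite graph $F$, with last coordinate $0$. **Theorem.** As $n\to\infty$, $\nu(T_n)\to\lambda$ and $\nu(T^L_n)\to\lambda$ in probability in $\mathcal P$. Moreover, $\Gamma_\lambda\in\mathcal U_\infty$, and $T_n\to\Gamma_\lambda$ and $T^L_n\to\Gamma_\lambda$ in probability in $\overline{\mathcal U}$. -/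

import Mathlib

open MeasureTheory ProbabilityTheory Filter Topology
open scoped unitInterval

noncomputable section

/-! ### Threshold graphs, labeled and unlabeled -/

/-- `G` is a threshold graph: there are real weights `w` and a threshold `t` such that two distinct
vertices `i`, `j` are adjacent iff `w i + w j > t`. -/
def IsThreshold {V : Type*} (G : SimpleGraph V) : Prop :=
  ∃ (w : V → ℝ) (t : ℝ), ∀ i j, i ≠ j → (G.Adj i j ↔ t < w i + w j)

/-- Isomorphism of graphs on the vertex set `Fin n`. -/
instance graphIsoSetoid (n : ℕ) : Setoid (SimpleGraph (Fin n)) where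
  r G H := Nonempty (G ≃g H)
  iseqv :=
    { refl := fun _ => ⟨RelIso.refl _⟩
      symm := fun ⟨e⟩ => ⟨e.symm⟩
      trans := fun ⟨e⟩ ⟨f⟩ => ⟨e.trans f⟩ }

/-- Unlabeled graphs with `n` vertices: isomorphism classes of graphs on `Fin n`. -/
def UnlabeledGraph (n : ℕ) : Type := Quotient (graphIsoSetoid n)

/-- The isomorphism class of a labeled graph. -/
def toUnlabeled {n : ℕ} (G : SimpleGraph (Fin n)) : UnlabeledGraph n := Quotient.mk _ G

theorem IsThreshold.of_iso {V W : Type*} {G : SimpleGraph V} {H : SimpleGraph W} (e : G ≃g H)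
    (h : IsThreshold G) : IsThreshold H := by
  obtain ⟨w, t, hw⟩ := h
  refine ⟨fun i => w (e.symm i), t, fun i j hij => ?_⟩
  rw [← hw _ _ (fun h => hij (e.symm.injective h)), e.symm.map_adj_iff]

/-- An unlabeled graph is a threshold graph if its labeled representatives are. -/
def UnlabeledGraph.IsThreshold {n : ℕ} (G : UnlabeledGraph n) : Prop :=
  Quotient.lift (s := graphIsoSetoid n)
    (fun H : SimpleGraph (Fin n) => _root_.IsThreshold H)
    (fun _ _ ⟨e⟩ => propext ⟨fun h => h.of_iso e, fun h => h.of_iso e.symm⟩) G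

/-- The set of labeled threshold graphs with vertex set `Fin n`. -/
def LabeledThresholdGraph (n : ℕ) : Type := {G : SimpleGraph (Fin n) // IsThreshold G}

/-- The set of unlabeled threshold graphs with `n` vertices. -/
def UnlabeledThresholdGraph (n : ℕ) : Type := {G : UnlabeledGraph n // G.IsThreshold}

/-- Both sets are finite; they carry the discrete `σ`-algebra. -/
instance (n : ℕ) : MeasurableSpace (LabeledThresholdGraph n) := ⊤

instance (n : ℕ) : MeasurableSpace (UnlabeledThresholdGraph n) := ⊤

/-! ### Normalized degree distributions -/

open Classical in
/-- The normalized degree `d(v) / v(G)`, as a point of `[0,1]`. -/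
def normalizedDegree {n : ℕ} (G : SimpleGraph (Fin n)) (v : Fin n) : I :=
  ⟨(G.degree v : ℝ) / n, by
    have h : G.degree v < n := by simpa using G.degree_lt_card_verts v
    have h' : (G.degree v : ℝ) ≤ n := by exact_mod_cast h.le
    exact ⟨by positivity, div_le_one_of_le₀ h' (by positivity)⟩⟩

/-- The normalized degree distribution of a graph with `n ≥ 1` vertices: the empirical
distribution of its normalized degrees, a probability measure on `[0,1]`. -/
def degreeDistribution {n : ℕ+} (G : SimpleGraph (Fin n)) : ProbabilityMeasure I :=
  ⟨((n : ℕ) : ENNReal)⁻¹ • ∑ v : Fin n, Measure.dirac (normalizedDegree G v), ⟨by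
    have h0 : ((n : ℕ) : ENNReal) ≠ 0 := by simp
    simp [ENNReal.inv_mul_cancel h0 (ENNReal.natCast_ne_top _)]⟩⟩

theorem normalizedDegree_iso {n : ℕ} {G H : SimpleGraph (Fin n)} (e : G ≃g H) (v : Fin n) :
    normalizedDegree H (e v) = normalizedDegree G v := by
  classical
  simp [normalizedDegree]

theorem degreeDistribution_iso {n : ℕ+} {G H : SimpleGraph (Fin n)} (e : G ≃g H) :
    degreeDistribution G = degreeDistribution H := by
  apply Subtype.ext
  change _ • _ = _ • _
  congr 1
  exact Fintype.sum_equiv e.toEquiv _ _ fun v => by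
    rw [← normalizedDegree_iso e v]; rfl

/-- The normalized degree distribution of an unlabeled graph. -/
def UnlabeledGraph.degreeDistribution {n : ℕ+} (G : UnlabeledGraph n) : ProbabilityMeasure I :=
  Quotient.lift (s := graphIsoSetoid n)
    (fun H : SimpleGraph (Fin n) => _root_.degreeDistribution H)
    (fun _ _ ⟨e⟩ => degreeDistribution_iso e) G

/-- The uniform distribution on `[0,1]`. -/
def uniformUnitInterval : ProbabilityMeasure I := ⟨volume, inferInstance⟩

/-! ### Homomorphism densities, graph limits -/

/-- `t(F, G)`: the probability that a uniformly random map `V(F) → V(G)` is a homomorphism. -/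
def homDensity {V W : Type*} (F : SimpleGraph V) (G : SimpleGraph W) : ℝ :=
  (Nat.card (F →g G) : ℝ) / (Nat.card (V → W) : ℝ)

theorem homDensity_iso {V W W' : Type*} (F : SimpleGraph V) {G : SimpleGraph W}
    {H : SimpleGraph W'} (e : G ≃g H) : homDensity F G = homDensity F H := by
  unfold homDensity
  have h1 : Nat.card (F →g G) = Nat.card (F →g H) := Nat.card_congr
    { toFun := fun f => e.toHom.comp f
      invFun := fun f => e.symm.toHom.comp f
      left_inv := fun f => by ext x; simp
      right_inv := fun f => by ext x; simp }
  have h2 : Nat.card (V → W) = Nat.card (V → W') :=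
    Nat.card_congr (Equiv.arrowCongr (Equiv.refl V) e.toEquiv)
  rw [h1, h2]

/-- `t(F, G)` for an unlabeled graph `G`. -/
def UnlabeledGraph.homDensity {V : Type*} (F : SimpleGraph V) {n : ℕ} (G : UnlabeledGraph n) : ℝ :=
  Quotient.lift (s := graphIsoSetoid n)
    (fun H : SimpleGraph (Fin n) => _root_.homDensity F H)
    (fun _ _ ⟨e⟩ => homDensity_iso F e) G

/-- The ambient space of the compactification of the set of unlabeled graphs: a point records
a value for each test graph `F` and one further real number (the inverse order). It carries the
product topology. -/
abbrev GraphSpace : Type := ((Σ k : ℕ, SimpleGraph (Fin k)) → ℝ) × ℝ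

/-- The embedding `G ↦ ((t(F, G))_F, 1 / v(G))` of the set of unlabeled (nonempty) graphs. -/
def UnlabeledGraph.toGraphSpace {n : ℕ+} (G : UnlabeledGraph n) : GraphSpace :=
  (fun F => G.homDensity F.2, ((n : ℕ) : ℝ)⁻¹)

/-- The image in `GraphSpace` of the set of all unlabeled graphs. -/
def unlabeledGraphs : Set GraphSpace :=
  {p | ∃ (n : ℕ+) (G : UnlabeledGraph n), p = G.toGraphSpace}

/-- The proper limit elements (graph limits): the points of the closure of the set of unlabeled
graphs that are not graphs. The closure is a compact metrizable space, in which a sequence of graphs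
`G n` converges to a graph limit `Γ` iff `v(G n) → ∞` and `t(F, G n) → t(F, Γ)` for every `F`. -/
def graphLimits : Set GraphSpace := closure unlabeledGraphs \ unlabeledGraphs

/-- Symmetric measurable functions `[0,1]² → [0,1]`. -/
structure Graphon where
  toFun : I → I → I
  symm : ∀ x y, toFun x y = toFun y x
  measurable : Measurable fun p : I × I => toFun p.1 p.2

open Classical in
/-- `t(F, W) = ∫_{[0,1]^k} ∏_{ij ∈ E(F)} W(x_i, x_j) dx`, each edge being listed once, with `i < j`. -/
def Graphon.homDensity (W : Graphon) {k : ℕ} (F : SimpleGraph (Fin k)) : ℝ :=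
  ∫ x : Fin k → I,
    ∏ p : Fin k × Fin k with p.1 < p.2 ∧ F.Adj p.1 p.2, (W.toFun (x p.1) (x p.2) : ℝ)

/-- The graph limit `Γ_W` defined by `W`. -/
def Graphon.graphLimit (W : Graphon) : GraphSpace := (fun F => W.homDensity F.2, 0)

/-! ### Threshold graph limits -/

/-- `S_μ = {(x, y) ∈ [0,1]² : x ≥ μ[0, 1 - y)}`. -/
def thresholdSet (μ : ProbabilityMeasure I) : Set (I × I) :=
  {p | (μ : Measure I).real (Set.Iio (unitInterval.symm p.2)) ≤ p.1}

/-- The set `S_μ` is invariant under reflection in the main diagonal. -/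
def IsReflectionInvariant (μ : ProbabilityMeasure I) : Prop :=
  ∀ x y : I, (x, y) ∈ thresholdSet μ ↔ (y, x) ∈ thresholdSet μ

theorem measurableSet_thresholdSet (μ : ProbabilityMeasure I) :
    MeasurableSet (thresholdSet μ) := by
  have h : Measurable fun y : I => (μ : Measure I).real (Set.Iio (unitInterval.symm y)) := by
    apply Antitone.measurable
    intro a b hab
    exact measureReal_mono (Set.Iio_subset_Iio (by simpa using hab))
  exact measurableSet_le (h.comp measurable_snd) (measurable_subtype_coe.comp measurable_fst)

open Classical in
/-- `W_μ`, the indicator function of `S_μ`. -/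
def thresholdGraphon (μ : ProbabilityMeasure I) (hμ : IsReflectionInvariant μ) : Graphon where
  toFun x y := if (x, y) ∈ thresholdSet μ then 1 else 0
  symm x y := by simp only [hμ x y]
  measurable := Measurable.ite (measurableSet_thresholdSet μ) measurable_const measurable_const

/-- `Γ_μ`, the graph limit defined by `W_μ`. -/
def thresholdLimit (μ : ProbabilityMeasure I) (hμ : IsReflectionInvariant μ) : GraphSpace :=
  (thresholdGraphon μ hμ).graphLimit

/-- For the uniform distribution, `S_λ = {(x, y) : x + y ≥ 1}`. -/
theorem mem_thresholdSet_uniform (x y : I) :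
    (x, y) ∈ thresholdSet uniformUnitInterval ↔ (1 : ℝ) ≤ x + y := by
  have h : (0 : ℝ) ≤ 1 - y := sub_nonneg.2 y.2.2
  have h2 : (volume : Measure I).real (Set.Iio (unitInterval.symm y)) = 1 - y := by
    rw [Measure.real, unitInterval.volume_Iio, unitInterval.coe_symm_eq, ENNReal.toReal_ofReal h]
  change (volume : Measure I).real (Set.Iio (unitInterval.symm y)) ≤ (x : ℝ) ↔ _
  rw [h2, sub_le_iff_le_add]

theorem uniform_isReflectionInvariant : IsReflectionInvariant uniformUnitInterval := fun x y => by
  rw [mem_thresholdSet_uniform, mem_thresholdSet_uniform, add_comm]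

/-! ### Convergence in probability -/

/-- Convergence in probability of random elements `X n` (each on its own probability space) of a
metrizable space to a constant `c`: the probability of lying outside any given neighbourhood of `c`
tends to `0`. For any metric inducing the topology this says `P(d(X n, c) > ε) → 0` for
all `ε > 0`. -/
def TendstoInProbability {ι : Type*} [Preorder ι] {Ω : ι → Type*} [∀ n, MeasurableSpace (Ω n)]
    (P : ∀ n, Measure (Ω n)) {E : Type*} [TopologicalSpace E] (X : ∀ n, Ω n → E) (c : E) : Prop :=
  ∀ U ∈ 𝓝 c, Tendsto (fun n => P n {ω | X n ω ∉ U}) atTop (𝓝 0)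

end

/-! A threshold graph arises by adding vertices one at a time, each joined to all earlier ones (bit
true) or to none (bit false). Place the vertex added at position `i`, counted from 0, at the point
1/2 ± (i+1)/(2n), with plus for the bit true. Distinct vertices are adjacent exactly when their
points sum to more than 1 (`bitGraph_adj_iff_bitPosition`), so the graph is W_λ sampled at these
points. If the partial sums of the signs are small, as measured by `discrepancy`, then the points
are nearly equidistributed by Abel summation, and the normalized degrees are close to the points on
average. This gives the limit of the degree distributions. It also gives that of the homomorphism
densities, each being the mass of an open region with null frontier under a power of the empirical
measure.

It remains to see that few threshold graphs have large discrepancy. The first bit is never read. Up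
to that bit, an unlabeled graph determines its bits, and a labeled graph determines its sorted
construction sequence (`bitGraph_injOn`). For a fixed order π the sorted bit sequences are those
that change at every descent of π past the first position. Forced changes create only nonpositive
correlations, so a partial sum of m signs has second moment at most m, and Markov's inequality
leaves a proportion O(1/√n) of discrepancy at least ε, uniformly in π. Summing over π handles
labeled graphs; no forced changes and π = 1 handle unlabeled ones. -/

noncomputable section

/-! ### Threshold graphs built from bit sequences -/

/-- The graph obtained by adding the vertices `π 0, π 1, …` one at a time, the vertex `π j` being
joined to all earlier vertices if `b j` is true and to none of them otherwise. -/
def bitGraph {n : ℕ} (π : Equiv.Perm (Fin n)) (b : Fin n → Bool) : SimpleGraph (Fin n) where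
  Adj u v := u ≠ v ∧ b (max (π.symm u) (π.symm v)) = true
  symm := ⟨fun u v h => ⟨h.1.symm, by rw [max_comm]; exact h.2⟩⟩
  loopless := ⟨fun _ h => h.1 rfl⟩

theorem bitGraph_adj {n : ℕ} {π : Equiv.Perm (Fin n)} {b : Fin n → Bool} {u v : Fin n} :
    (bitGraph π b).Adj u v ↔ u ≠ v ∧ b (max (π.symm u) (π.symm v)) = true := Iff.rfl

theorem bitGraph_adj_apply {n : ℕ} {π : Equiv.Perm (Fin n)} {b : Fin n → Bool} {i j : Fin n}
    (h : i < j) : (bitGraph π b).Adj (π i) (π j) ↔ b j = true := by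
  simp [bitGraph_adj, h.ne, max_eq_right h.le]

/-- The sign `±1` of a bit. -/
def bitSign (c : Bool) : ℝ := if c then 1 else -1

@[simp] theorem bitSign_true : bitSign true = 1 := rfl
@[simp] theorem bitSign_false : bitSign false = -1 := rfl

/-- Signed weights representing `bitGraph π b` as a threshold graph with threshold `0`. -/
theorem bitGraph_adj_iff_weights {n : ℕ} {π : Equiv.Perm (Fin n)} {b : Fin n → Bool} {u v : Fin n}
    (h : u ≠ v) : (bitGraph π b).Adj u v ↔
      0 < bitSign (b (π.symm u)) * ((π.symm u : ℕ) + 1 : ℝ) +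
        bitSign (b (π.symm v)) * ((π.symm v : ℕ) + 1 : ℝ) := by
  wlog huv : π.symm u < π.symm v generalizing u v
  · rw [SimpleGraph.adj_comm, add_comm]
    exact this h.symm (lt_of_le_of_ne (not_lt.1 huv) fun e => h (π.symm.injective e).symm)
  rw [bitGraph_adj, max_eq_right huv.le]
  have h1 : ((π.symm u : ℕ) : ℝ) < (π.symm v : ℕ) := by exact_mod_cast huv
  have h2 : (0 : ℝ) ≤ (π.symm u : ℕ) := by positivity
  cases b (π.symm u) <;> cases b (π.symm v) <;> simp [h] <;> first | linarith | exact huv.le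

theorem bitGraph_isThreshold {n : ℕ} (π : Equiv.Perm (Fin n)) (b : Fin n → Bool) :
    IsThreshold (bitGraph π b) :=
  ⟨fun u => bitSign (b (π.symm u)) * ((π.symm u : ℕ) + 1 : ℝ), 0, fun _ _ h =>
    bitGraph_adj_iff_weights h⟩

/-- The sign of `w u + w v - t` is that of whichever weight lies farther from `t / 2`, so adding
vertices by increasing distance from `t / 2` makes the later vertex decide. -/
theorem IsThreshold.exists_bitGraph {n : ℕ} {G : SimpleGraph (Fin n)} (hG : IsThreshold G) :
    ∃ π b, bitGraph π b = G := by
  obtain ⟨w, t, hw⟩ := hG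
  -- At equal distance the weights may cancel, which means nonadjacency; hence the low weights come
  -- last among ties.
  let key : Fin n → ℝ ×ₗ Bool := fun v => toLex (|w v - t / 2|, decide (w v ≤ t / 2))
  let π := Tuple.sort key
  have hmono : Monotone (key ∘ π) := Tuple.monotone_sort key
  refine ⟨π, fun i => decide (t / 2 < w (π i)), ?_⟩
  ext u v
  wlog huv : π.symm u < π.symm v generalizing u v
  · by_cases h : u = v
    · simp [h]
    rw [SimpleGraph.adj_comm, G.adj_comm]
    exact this v u (lt_of_le_of_ne (not_lt.1 huv) fun e => h (π.symm.injective e).symm)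
  have hne : u ≠ v := by rintro rfl; exact lt_irrefl _ huv
  have hk : key u ≤ key v := by simpa using hmono huv.le
  rw [bitGraph_adj, max_eq_right huv.le, hw u v hne]
  simp only [ne_eq, hne, not_false_eq_true, Equiv.apply_symm_apply, decide_eq_true_eq, true_and]
  rw [Prod.Lex.toLex_le_toLex] at hk
  simp only at hk
  constructor
  · intro hv
    rw [abs_of_pos (sub_pos.2 hv)] at hk
    rcases hk with h | ⟨h, h'⟩
    · have := neg_abs_le (w u - t / 2); linarith
    · have hu : t / 2 < w u := by
        by_contra hc
        simp only [not_lt.1 hc, not_le.2 hv, decide_true, decide_false] at h'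
        exact absurd h' (by decide)
      linarith
  · intro h
    by_contra hv
    rw [abs_of_nonpos (sub_nonpos.2 (not_lt.1 hv))] at hk
    have := le_abs_self (w u - t / 2)
    rcases hk with h' | ⟨h', -⟩ <;> linarith

/-! ### Sorted construction sequences -/

/-- The construction sequence is sorted: labels increase along each run of equal bits, the first
vertex belonging to the first run whatever its bit. -/
def IsSorted {n : ℕ} (π : Equiv.Perm (Fin n)) (b : Fin n → Bool) : Prop :=
  ∀ (i : ℕ) (h : i + 1 < n), i = 0 ∨ b ⟨i, by omega⟩ = b ⟨i + 1, h⟩ →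
    π ⟨i, by omega⟩ < π ⟨i + 1, h⟩

/-- Only the bit of the later vertex is read, so neighbours with equal bits can be exchanged. At
positions 0 and 1 the bits may differ, because the bit at 0 is never read. -/
theorem bitGraph_mul_swap {n : ℕ} (π : Equiv.Perm (Fin n)) (b : Fin n → Bool) (i : ℕ)
    (h : i + 1 < n) (hb : i = 0 ∨ b ⟨i, by omega⟩ = b ⟨i + 1, h⟩) :
    bitGraph (π * Equiv.swap ⟨i, by omega⟩ ⟨i + 1, h⟩) b = bitGraph π b := by
  ext u v
  simp only [bitGraph_adj]
  refine and_congr_right fun huv => ?_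
  have key : ∀ p q : Fin n, p ≠ q →
      b (max (Equiv.swap ⟨i, by omega⟩ ⟨i + 1, h⟩ p) (Equiv.swap ⟨i, by omega⟩ ⟨i + 1, h⟩ q)) =
        b (max p q) := by
    intro p q hpq
    wlog hlt : p < q generalizing p q
    · rw [max_comm, max_comm p q]
      exact this q p hpq.symm (lt_of_le_of_ne (not_lt.1 hlt) hpq.symm)
    rw [max_eq_right hlt.le]
    by_cases hq : q = ⟨i, by omega⟩
    · have h1 : (p : ℕ) < i := by rwa [hq] at hlt
      rw [hq, Equiv.swap_apply_left, Equiv.swap_apply_of_ne_of_ne (by simp [Fin.ext_iff]; omega)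
        (by simp [Fin.ext_iff]; omega), max_eq_right (by simp [Fin.le_def]; omega)]
      exact (hb.resolve_left (by omega)).symm
    by_cases hq' : q = ⟨i + 1, h⟩
    · have h1 : (p : ℕ) < i + 1 := by rwa [hq'] at hlt
      by_cases hp : p = ⟨i, by omega⟩
      · rw [hq', hp, Equiv.swap_apply_left, Equiv.swap_apply_right, max_eq_left (by simp [Fin.le_def])]
      · have h2 : (p : ℕ) ≠ i := fun e => hp (Fin.ext e)
        rw [hq', Equiv.swap_apply_right, Equiv.swap_apply_of_ne_of_ne hp (hq' ▸ hlt.ne),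
          max_eq_right (by simp [Fin.le_def]; omega)]
        exact hb.resolve_left (by omega)
    rw [Equiv.swap_apply_of_ne_of_ne hq hq']
    congr 1
    rw [max_eq_right]
    have h1 : (p : ℕ) < q := hlt
    have h2 : (q : ℕ) ≠ i := fun e => hq (Fin.ext e)
    have h3 : (q : ℕ) ≠ i + 1 := fun e => hq' (Fin.ext e)
    rw [Equiv.swap_apply_def]
    split_ifs with h4 h5
    · rw [Fin.ext_iff] at h4; simp only [Fin.le_def] at h4 ⊢; omega
    · rw [Fin.ext_iff] at h5; simp only [Fin.le_def] at h5 ⊢; omega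
    · exact hlt.le
  have := key (π.symm u) (π.symm v) (π.symm.injective.ne huv)
  rw [← this]
  simp [Equiv.Perm.mul_def]

theorem exists_isSorted {n : ℕ} (π : Equiv.Perm (Fin n)) (b : Fin n → Bool) :
    ∃ τ, IsSorted τ b ∧ bitGraph τ b = bitGraph π b := by
  classical
  -- A maximizer of this pairing of positions with labels is sorted: exchanging a forbidden descent
  -- at adjacent positions `p`, `q` would raise it by `τ p - τ q > 0`.
  let F : Equiv.Perm (Fin n) → ℤ := fun τ => ∑ j : Fin n, (j : ℤ) * (τ j : ℕ)
  obtain ⟨τ, hτ, hmax⟩ := Finset.exists_max_image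
    (Finset.univ.filter fun τ : Equiv.Perm (Fin n) => bitGraph τ b = bitGraph π b) F
    ⟨π, by simp⟩
  simp only [Finset.mem_filter, Finset.mem_univ, true_and] at hτ hmax
  refine ⟨τ, fun i h hb => ?_, hτ⟩
  by_contra hlt
  have h0 := hmax (τ * Equiv.swap ⟨i, by omega⟩ ⟨i + 1, h⟩)
    ((bitGraph_mul_swap τ b i h hb).trans hτ)
  set p : Fin n := ⟨i, by omega⟩ with hp
  set q : Fin n := ⟨i + 1, h⟩ with hq
  have hpq : p ≠ q := by simp [hp, hq]
  have hne : τ p ≠ τ q := τ.injective.ne hpq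
  have hlt' : τ q < τ p := lt_of_le_of_ne (not_lt.1 hlt) hne.symm
  have e1 : F (τ * Equiv.swap p q) = ∑ j : Fin n, ((Equiv.swap p q j : Fin n) : ℤ) * (τ j : ℕ) := by
    rw [← Equiv.sum_comp (Equiv.swap p q)]
    simp [F]
  have e2 : F (τ * Equiv.swap p q) - F τ =
      ∑ j ∈ ({p, q} : Finset (Fin n)), (((Equiv.swap p q j : Fin n) : ℤ) - j) * (τ j : ℕ) := by
    rw [e1, ← Finset.sum_sub_distrib]
    symm
    refine (Finset.sum_subset (Finset.subset_univ _) fun j _ hj => ?_).trans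
      (Finset.sum_congr rfl fun j _ => by ring)
    simp only [Finset.mem_insert, Finset.mem_singleton, not_or] at hj
    simp [Equiv.swap_apply_of_ne_of_ne hj.1 hj.2]
  rw [Finset.sum_pair hpq, Equiv.swap_apply_left, Equiv.swap_apply_right] at e2
  have e3 : ((q : ℕ) : ℤ) = (p : ℕ) + 1 := by simp [hp, hq]
  have e4 : ((τ q : ℕ) : ℤ) < (τ p : ℕ) := by exact_mod_cast hlt'
  rw [e3] at e2
  have : F (τ * Equiv.swap p q) - F τ = (τ p : ℕ) - (τ q : ℕ) := by rw [e2]; ring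
  linarith

/-- A sorted construction sequence assigns to a vertex twin to the last one a smaller label. -/
theorem IsSorted.apply_le {n : ℕ} {π : Equiv.Perm (Fin n)} {b : Fin n → Bool} (hs : IsSorted π b)
    {k : Fin n} {u : Fin n} (hu : π.symm u < k)
    (ht : ∀ j, j ≤ k → j ≠ π.symm u → ((bitGraph π b).Adj u (π j) ↔ b k = true)) :
    u < π k := by
  obtain ⟨i, rfl⟩ := π.surjective u
  simp only [Equiv.symm_apply_apply] at hu ht
  -- Being a twin of the vertex at `k` forces all bits from `i` to `k` to agree, so these positions
  -- lie in one run; for `i = 0` the own bit is not visible and not needed.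
  have hb : ∀ j, i < j → j ≤ k → b j = b k := fun j h1 h2 => by
    have := (bitGraph_adj_apply h1).symm.trans (ht j h2 h1.ne')
    exact Bool.eq_iff_iff.2 this
  have hbi : (i : ℕ) ≠ 0 → b i = b k := fun h => by
    have h0 : (⟨0, by omega⟩ : Fin n) < i := by simp [Fin.lt_def]; omega
    have := ht ⟨0, by omega⟩ (h0.le.trans hu.le) h0.ne
    rw [SimpleGraph.adj_comm, bitGraph_adj_apply h0] at this
    exact Bool.eq_iff_iff.2 this
  have step : ∀ m (hm : m < n), (i : ℕ) < m → m ≤ k → π i < π ⟨m, hm⟩ := by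
    intro m hm him hmk
    induction m with
    | zero => omega
    | succ m ih =>
      have hstep : π ⟨m, by omega⟩ < π ⟨m + 1, hm⟩ := by
        refine hs m hm ?_
        by_cases h0 : m = 0
        · exact Or.inl h0
        right
        rw [hb ⟨m + 1, hm⟩ (by simpa [Fin.lt_def] using him) (by simpa [Fin.le_def] using hmk)]
        rcases (Nat.lt_succ_iff.1 him).eq_or_lt with h | h
        · have : (⟨m, by omega⟩ : Fin n) = i := Fin.ext h.symm
          rw [this]; exact hbi (by omega)
        · exact hb _ (by simpa [Fin.lt_def] using h) (by simp [Fin.le_def]; omega)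
      rcases (Nat.lt_succ_iff.1 him).eq_or_lt with h | h
      · have : (⟨m, by omega⟩ : Fin n) = i := Fin.ext h.symm
        rwa [this] at hstep
      · exact (ih (by omega) h (by omega)).trans hstep
  exact step k k.2 hu le_rfl

theorem symm_lt_of_forall_lt_eq {n : ℕ} {π τ : Equiv.Perm (Fin n)} {k j : Fin n}
    (h : ∀ i, k < i → π i = τ i) (hj : j ≤ k) : π.symm (τ j) ≤ k := by
  by_contra hc
  have := h _ (not_le.1 hc)
  rw [Equiv.apply_symm_apply] at this
  have := τ.injective this
  rw [← this] at hc
  exact hc hj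

/-- A sorted construction sequence is determined by the graph, apart from the bit of the first
vertex. -/
theorem bitGraph_injOn {n : ℕ} {π τ : Equiv.Perm (Fin n)} {b c : Fin n → Bool}
    (hπ : IsSorted π b) (hτ : IsSorted τ c) (h : bitGraph π b = bitGraph τ c) :
    π = τ ∧ ∀ i : Fin n, (i : ℕ) ≠ 0 → b i = c i := by
  -- Peel vertices off from the end. If the orders agree beyond `k`, the same vertices remain in
  -- both. Were `π k ≠ τ k`, both would be dominating or both isolated among these, hence twins, and
  -- sortedness would make each label smaller than the other.
  have key : ∀ k : Fin n, (∀ i, k < i → π i = τ i) →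
      π k = τ k ∧ ((k : ℕ) ≠ 0 → b k = c k) := by
    intro k hk
    have adjπ : ∀ j, j < k → ((bitGraph π b).Adj (π j) (π k) ↔ b k = true) :=
      fun j hj => bitGraph_adj_apply hj
    have adjτ : ∀ j, j < k → ((bitGraph π b).Adj (τ j) (τ k) ↔ c k = true) :=
      fun j hj => h ▸ bitGraph_adj_apply hj
    have mτ : ∀ j, j ≤ k → π.symm (τ j) ≤ k := fun j hj => symm_lt_of_forall_lt_eq hk hj
    have mπ : ∀ j, j ≤ k → τ.symm (π j) ≤ k :=
      fun j hj => symm_lt_of_forall_lt_eq (fun i hi => (hk i hi).symm) hj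
    have aπ : ∀ j, j ≤ k → τ j ≠ π k → ((bitGraph π b).Adj (τ j) (π k) ↔ b k = true) := by
      intro j hj hne
      have := adjπ (π.symm (τ j)) (lt_of_le_of_ne (mτ j hj) fun e => hne (by
        rw [← e, Equiv.apply_symm_apply]))
      rwa [Equiv.apply_symm_apply] at this
    have aτ : ∀ j, j ≤ k → π j ≠ τ k → ((bitGraph π b).Adj (π j) (τ k) ↔ c k = true) := by
      intro j hj hne
      have := adjτ (τ.symm (π j)) (lt_of_le_of_ne (mπ j hj) fun e => hne (by
        rw [← e, Equiv.apply_symm_apply]))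
      rwa [Equiv.apply_symm_apply] at this
    by_cases hne : π k = τ k
    · refine ⟨hne, fun h0 => ?_⟩
      have hlt : (⟨0, by omega⟩ : Fin n) < k := by simp [Fin.lt_def]; omega
      have h1 := adjπ _ hlt
      have h2 := aτ _ hlt.le (by rw [← hne]; exact π.injective.ne hlt.ne)
      rw [← hne] at h2
      exact Bool.eq_iff_iff.2 (h1.symm.trans h2)
    · exfalso
      have hbc : b k = true ↔ c k = true := by
        have h1 := aπ k le_rfl (Ne.symm hne)
        have h2 := aτ k le_rfl hne
        rw [SimpleGraph.adj_comm] at h2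
        exact h1.symm.trans h2
      have l1 : τ k < π k := by
        refine hπ.apply_le (lt_of_le_of_ne (mτ k le_rfl) fun e =>
          hne ((Equiv.symm_apply_eq _).1 e).symm) fun j hj hjk => ?_
        rw [SimpleGraph.adj_comm, aτ j hj (fun e => hjk (by rw [← e, Equiv.symm_apply_apply])), hbc]
      have l2 : π k < τ k := by
        refine hτ.apply_le (lt_of_le_of_ne (mπ k le_rfl) fun e =>
          hne ((Equiv.symm_apply_eq _).1 e)) fun j hj hjk => ?_
        rw [← h, SimpleGraph.adj_comm,
          aπ j hj (fun e => hjk (by rw [← e, Equiv.symm_apply_apply])), hbc]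
      exact lt_asymm l1 l2
  have all : ∀ m (k : Fin n), n - k ≤ m → π k = τ k := by
    intro m
    induction m with
    | zero => intro k hk; omega
    | succ m ih =>
      intro k hk
      exact (key k fun i hi => ih i (by rw [Fin.lt_def] at hi; omega)).1
  have hπτ : π = τ := Equiv.ext fun k => all _ k le_rfl
  exact ⟨hπτ, fun i => (key i fun j _ => by rw [hπτ]).2⟩


/-! ### Sign sums of bit sequences and their second moments -/

/-- The sequence of signs of a bit sequence, extended by zero. -/
def signSeq {n : ℕ} (b : Fin n → Bool) (i : ℕ) : ℝ := if h : i < n then bitSign (b ⟨i, h⟩) else 0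

theorem signSeq_of_lt {n : ℕ} (b : Fin n → Bool) {i : ℕ} (h : i < n) :
    signSeq b i = bitSign (b ⟨i, h⟩) := dif_pos h

theorem signSeq_mul_self {n : ℕ} (b : Fin n → Bool) {i : ℕ} (h : i < n) :
    signSeq b i * signSeq b i = 1 := by
  rw [signSeq_of_lt b h]
  cases b ⟨i, h⟩ <;> simp

/-- The partial sums of the signs of a bit sequence. -/
def signSum {n : ℕ} (b : Fin n → Bool) (m : ℕ) : ℝ := ∑ i ∈ Finset.range m, signSeq b i

theorem signSum_succ {n : ℕ} (b : Fin n → Bool) (m : ℕ) :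
    signSum b (m + 1) = signSum b m + signSeq b m := Finset.sum_range_succ _ _

@[simp] theorem signSum_zero {n : ℕ} (b : Fin n → Bool) : signSum b 0 = 0 := rfl

/-- The averaged discrepancy of a bit sequence. -/
def discrepancy {n : ℕ} (b : Fin n → Bool) : ℝ :=
  (∑ m ∈ Finset.range (n + 1), |signSum b m|) / (n : ℝ) ^ 2 + |signSum b n| / n

theorem discrepancy_nonneg {n : ℕ} (b : Fin n → Bool) : 0 ≤ discrepancy b := by
  unfold discrepancy; positivity

open Classical in
/-- The bit sequences in which the bit changes after each position in `D`. -/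
def changeSet (n : ℕ) (D : Set ℕ) : Finset (Fin n → Bool) :=
  Finset.univ.filter fun b => ∀ (i : ℕ) (h : i + 1 < n), i ∈ D →
    b ⟨i + 1, h⟩ = !b ⟨i, by omega⟩

theorem mem_changeSet {n : ℕ} {D : Set ℕ} {b : Fin n → Bool} : b ∈ changeSet n D ↔
    ∀ (i : ℕ) (h : i + 1 < n), i ∈ D → b ⟨i + 1, h⟩ = !b ⟨i, by omega⟩ := by
  simp [changeSet]

open Classical in
/-- Flip the bits at the positions in `A`. -/
def flipOn {n : ℕ} (A : Set ℕ) (b : Fin n → Bool) (i : Fin n) : Bool :=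
  if (i : ℕ) ∈ A then !b i else b i

theorem flipOn_flipOn {n : ℕ} (A : Set ℕ) (b : Fin n → Bool) : flipOn A (flipOn A b) = b := by
  ext i
  by_cases h : (i : ℕ) ∈ A <;> simp [flipOn, h]

/-- By `hA`, the set `A` never separates the two positions of a forced change, so both bits flip or
neither does. -/
theorem flipOn_mem {n : ℕ} {A D : Set ℕ} (hA : ∀ i ∈ D, i ∈ A ↔ i + 1 ∈ A) {b : Fin n → Bool}
    (hb : b ∈ changeSet n D) : flipOn A b ∈ changeSet n D := by
  rw [mem_changeSet] at hb ⊢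
  intro i h hi
  have := hb i h hi
  by_cases hiA : i ∈ A
  · simp [flipOn, hiA, (hA i hi).1 hiA, this]
  · have hiA' : i + 1 ∉ A := fun h' => hiA ((hA i hi).2 h')
    simp [flipOn, hiA, hiA', this]

theorem sum_changeSet_flipOn {n : ℕ} {A D : Set ℕ} (hA : ∀ i ∈ D, i ∈ A ↔ i + 1 ∈ A)
    (f : (Fin n → Bool) → ℝ) :
    ∑ b ∈ changeSet n D, f (flipOn A b) = ∑ b ∈ changeSet n D, f b :=
  Finset.sum_nbij' (flipOn A) (flipOn A) (fun _ h => flipOn_mem hA h) (fun _ h => flipOn_mem hA h)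
    (fun _ _ => flipOn_flipOn A _) (fun _ _ => flipOn_flipOn A _) fun _ _ => rfl

theorem signSeq_flipOn_of_mem {n : ℕ} {A : Set ℕ} (b : Fin n → Bool) {i : ℕ} (h : i ∈ A) :
    signSeq (flipOn A b) i = -signSeq b i := by
  unfold signSeq
  split_ifs with hi
  · cases hb : b ⟨i, hi⟩ <;> simp [flipOn, h, hb]
  · simp

theorem signSeq_flipOn_of_notMem {n : ℕ} {A : Set ℕ} (b : Fin n → Bool) {i : ℕ} (h : i ∉ A) :
    signSeq (flipOn A b) i = signSeq b i := by
  simp [signSeq, flipOn, h]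

/-- On average over the change set, a forced change turns the correlation c of a sign with its past
into -c - 1, while at a free position the symmetry of flipping all later bits makes it 0. The
interval [-1, 0] is stable under both; the lower bound serves only the induction. -/
theorem sum_signSum_mul_signSeq_mem {n : ℕ} (D : Set ℕ) (m : ℕ) (hm : m < n) :
    -((changeSet n D).card : ℝ) ≤ ∑ b ∈ changeSet n D, signSum b m * signSeq b m ∧
      ∑ b ∈ changeSet n D, signSum b m * signSeq b m ≤ 0 := by
  induction m with
  | zero => simp
  | succ m ih =>
    obtain ⟨h1, h2⟩ := ih (by omega)
    by_cases hD : m ∈ D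
    · have : ∑ b ∈ changeSet n D, signSum b (m + 1) * signSeq b (m + 1) =
          -(∑ b ∈ changeSet n D, signSum b m * signSeq b m) - (changeSet n D).card := by
        rw [← Finset.sum_neg_distrib, Finset.card_eq_sum_ones, Nat.cast_sum,
          ← Finset.sum_sub_distrib]
        refine Finset.sum_congr rfl fun b hb => ?_
        have e : signSeq b (m + 1) = -signSeq b m := by
          rw [signSeq_of_lt b hm, signSeq_of_lt b (by omega : m < n), mem_changeSet.1 hb m hm hD]
          cases b ⟨m, by omega⟩ <;> simp
        have e2 := signSeq_mul_self b (by omega : m < n)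
        rw [signSum_succ, e]
        push_cast
        linear_combination -e2
      constructor <;> linarith
    · have hA : ∀ i ∈ D, i ∈ Set.Ioi m ↔ i + 1 ∈ Set.Ioi m := by
        intro i hi
        have : i ≠ m := fun e => hD (e ▸ hi)
        simp only [Set.mem_Ioi]; omega
      have := sum_changeSet_flipOn hA fun b : Fin n → Bool => signSum b (m + 1) * signSeq b (m + 1)
      have e : ∀ b : Fin n → Bool, signSum (flipOn (Set.Ioi m) b) (m + 1) = signSum b (m + 1) :=
        fun b => Finset.sum_congr rfl fun i hi => signSeq_flipOn_of_notMem b (by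
          simp only [Set.mem_Ioi, Finset.mem_range] at hi ⊢; omega)
      have e' : ∀ b : Fin n → Bool, signSeq (flipOn (Set.Ioi m) b) (m + 1) = -signSeq b (m + 1) :=
        fun b => signSeq_flipOn_of_mem b (by simp)
      simp only [e, e', mul_neg, Finset.sum_neg_distrib] at this
      have h0 : (0 : ℝ) ≤ (changeSet n D).card := by positivity
      constructor <;> linarith

/-- The second moment of a partial sum of signs is at most the number of its terms. -/
theorem sum_signSum_sq_le {n : ℕ} (D : Set ℕ) (m : ℕ) (hm : m ≤ n) :
    ∑ b ∈ changeSet n D, signSum b m ^ 2 ≤ m * (changeSet n D).card := by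
  induction m with
  | zero => simp
  | succ m ih =>
    have h1 := ih (by omega)
    have h2 := (sum_signSum_mul_signSeq_mem D m hm).2
    have : ∑ b ∈ changeSet n D, signSum b (m + 1) ^ 2 = ∑ b ∈ changeSet n D, signSum b m ^ 2 +
        2 * ∑ b ∈ changeSet n D, signSum b m * signSeq b m + (changeSet n D).card := by
      rw [Finset.mul_sum, Finset.card_eq_sum_ones, Nat.cast_sum, ← Finset.sum_add_distrib,
        ← Finset.sum_add_distrib]
      refine Finset.sum_congr rfl fun b hb => ?_
      have e2 := signSeq_mul_self b hm
      rw [signSum_succ]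
      push_cast
      linear_combination e2
    rw [this]
    push_cast
    linarith

/-- Instead of Cauchy–Schwarz, sum `2 * √n * |S| ≤ n + S ^ 2` and use the second moment. -/
theorem sum_abs_signSum_le {n : ℕ} (D : Set ℕ) (m : ℕ) (hm : m ≤ n) :
    ∑ b ∈ changeSet n D, |signSum b m| ≤ √n * (changeSet n D).card := by
  rcases Nat.eq_zero_or_pos n with rfl | hn
  · obtain rfl : m = 0 := by omega
    simp
  have hs : 0 < √(n : ℝ) := Real.sqrt_pos.2 (by exact_mod_cast hn)
  have hsq : √(n : ℝ) * √n = n := Real.mul_self_sqrt (by positivity)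
  have h1 := sum_signSum_sq_le D m hm
  have hmn : (m : ℝ) * (changeSet n D).card ≤ n * (changeSet n D).card := by gcongr
  have h2 : 2 * √n * ∑ b ∈ changeSet n D, |signSum b m| ≤
      ∑ b ∈ changeSet n D, (n + signSum b m ^ 2) := by
    rw [Finset.mul_sum]
    refine Finset.sum_le_sum fun b _ => ?_
    rw [← sq_abs (signSum b m)]
    nlinarith [sq_nonneg (√(n : ℝ) - |signSum b m|)]
  rw [Finset.sum_add_distrib, Finset.sum_const, nsmul_eq_mul] at h2
  have h3 : 2 * √n * ∑ b ∈ changeSet n D, |signSum b m| ≤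
      2 * √n * (√n * (changeSet n D).card) := by
    have : 2 * √(n : ℝ) * (√n * (changeSet n D).card) = 2 * (n * (changeSet n D).card) := by
      linear_combination 2 * ((changeSet n D).card : ℝ) * hsq
    linarith
  exact le_of_mul_le_mul_left h3 (by positivity)

theorem sum_discrepancy_le {n : ℕ} (hn : 0 < n) (D : Set ℕ) :
    (∑ b ∈ changeSet n D, discrepancy b) * √n ≤ 3 * (changeSet n D).card := by
  have hn' : (1 : ℝ) ≤ n := by exact_mod_cast hn
  have hsq : √(n : ℝ) * √n = n := Real.mul_self_sqrt (by positivity)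
  have h1 : ∑ b ∈ changeSet n D, discrepancy b ≤
      ((n + 1) * (√n * (changeSet n D).card)) / (n : ℝ) ^ 2 + √n * (changeSet n D).card / n := by
    unfold discrepancy
    rw [Finset.sum_add_distrib, ← Finset.sum_div, ← Finset.sum_div, Finset.sum_comm]
    gcongr
    · calc _ ≤ ∑ m ∈ Finset.range (n + 1), √n * ((changeSet n D).card : ℝ) :=
            Finset.sum_le_sum fun m hm => sum_abs_signSum_le D m (by
              simpa [Nat.lt_succ_iff] using hm)
        _ = _ := by simp
    · exact sum_abs_signSum_le D n le_rfl
  calc (∑ b ∈ changeSet n D, discrepancy b) * √n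
      ≤ (((n + 1) * (√n * (changeSet n D).card)) / (n : ℝ) ^ 2 +
        √n * (changeSet n D).card / n) * √n := by gcongr
    _ = ((n + 1) / n + 1) * (changeSet n D).card := by
        have : (n : ℝ) ≠ 0 := by positivity
        field_simp
        linear_combination ((changeSet n D).card : ℝ) * hsq
    _ ≤ 3 * (changeSet n D).card := by
        gcongr
        have : ((n : ℝ) + 1) / n ≤ 2 := by
          rw [div_le_iff₀ (by positivity)]; linarith
        linarith

theorem card_discrepancy_ge_le {n : ℕ} (hn : 0 < n) (D : Set ℕ) (ε : ℝ) :
    (((changeSet n D).filter fun b => ε ≤ discrepancy b).card : ℝ) * (ε * √n) ≤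
      3 * (changeSet n D).card := by
  refine le_trans ?_ (sum_discrepancy_le hn D)
  rw [← mul_assoc]
  gcongr
  calc _ = ∑ b ∈ (changeSet n D).filter fun b => ε ≤ discrepancy b, ε := by simp
    _ ≤ ∑ b ∈ (changeSet n D).filter fun b => ε ≤ discrepancy b, discrepancy b :=
        Finset.sum_le_sum fun b hb => (Finset.mem_filter.1 hb).2
    _ ≤ _ := Finset.sum_le_sum_of_subset_of_nonneg (Finset.filter_subset _ _)
        fun b _ _ => discrepancy_nonneg b

/-- Flipping the first bit preserves the change set when no change is forced after position 0. -/
theorem card_changeSet_le {n : ℕ} (hn : 0 < n) {D : Set ℕ} (hD : 0 ∉ D) :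
    (changeSet n D).card ≤ 2 * ((changeSet n D).filter fun b => b ⟨0, hn⟩ = true).card := by
  rw [← Finset.card_filter_add_card_filter_not (s := changeSet n D)
    (fun b => b ⟨0, hn⟩ = true), two_mul]
  refine Nat.add_le_add_left ?_ _
  have hA : ∀ i ∈ D, i ∈ ({0} : Set ℕ) ↔ i + 1 ∈ ({0} : Set ℕ) := by
    intro i hi
    have : i ≠ 0 := fun e => hD (e ▸ hi)
    simp [this]
  refine Finset.card_le_card_of_injOn (flipOn {0}) (fun b hb => ?_) fun b _ c _ h => by
    rw [← flipOn_flipOn {0} b, h, flipOn_flipOn]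
  simp only [Finset.coe_filter, Set.mem_ofPred_eq] at hb ⊢
  exact ⟨flipOn_mem hA hb.1, by simpa [flipOn] using hb.2⟩

/-! ### Counting graphs of large discrepancy -/

/-- Common to labeled and unlabeled graphs. Bad graphs are overcounted by bad sequences, and `Y` is
undercounted by the sequences with first bit true, on which `Φ` is injective. The constant 6 is 3
from the Markov bound times 2 for the first bit. -/
theorem card_mul_le_of_discrepancy {n : ℕ} (hn : 0 < n) {Y : Type*} [Fintype Y]
    (Φ : Equiv.Perm (Fin n) → (Fin n → Bool) → Y) (J : Finset (Equiv.Perm (Fin n)))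
    (D : Equiv.Perm (Fin n) → Set ℕ) (hD : ∀ π ∈ J, 0 ∉ D π)
    (hinj : ∀ π ∈ J, ∀ τ ∈ J, ∀ b ∈ changeSet n (D π), ∀ c ∈ changeSet n (D τ),
      b ⟨0, hn⟩ = true → c ⟨0, hn⟩ = true → Φ π b = Φ τ c → π = τ ∧ b = c)
    (W : Finset Y) {ε : ℝ} (hε : 0 < ε)
    (hW : ∀ y ∈ W, ∃ π ∈ J, ∃ b ∈ changeSet n (D π), Φ π b = y ∧ ε ≤ discrepancy b) :
    (W.card : ℝ) * (ε * √n) ≤ 6 * Fintype.card Y := by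
  classical
  have h1 : W.card ≤ ∑ π ∈ J, ((changeSet n (D π)).filter fun b => ε ≤ discrepancy b).card := by
    rw [← Finset.card_sigma]
    refine Finset.card_le_card_of_surjOn (fun p => Φ p.1 p.2) fun y hy => ?_
    obtain ⟨π, hπ, b, hb, rfl, hd⟩ := hW y hy
    exact ⟨⟨π, b⟩, by simp [hπ, hb, hd], rfl⟩
  have h2 : ∑ π ∈ J, ((changeSet n (D π)).filter fun b => b ⟨0, hn⟩ = true).card ≤
      Fintype.card Y := by
    rw [← Finset.card_sigma, ← Finset.card_univ]
    refine Finset.card_le_card_of_injOn (fun p => Φ p.1 p.2) (fun _ _ => by simp) ?_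
    rintro ⟨π, b⟩ hp ⟨τ, c⟩ hq h
    simp only [Finset.coe_sigma, Set.mem_sigma_iff, Finset.mem_coe, Finset.mem_filter] at hp hq
    obtain ⟨rfl, rfl⟩ := hinj π hp.1 τ hq.1 b hp.2.1 c hq.2.1 hp.2.2 hq.2.2 h
    rfl
  calc (W.card : ℝ) * (ε * √n)
      ≤ (∑ π ∈ J, (((changeSet n (D π)).filter fun b => ε ≤ discrepancy b).card : ℝ)) *
          (ε * √n) := by gcongr; exact_mod_cast h1
    _ = ∑ π ∈ J, (((changeSet n (D π)).filter fun b => ε ≤ discrepancy b).card : ℝ) *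
          (ε * √n) := Finset.sum_mul ..
    _ ≤ ∑ π ∈ J, 6 * (((changeSet n (D π)).filter fun b => b ⟨0, hn⟩ = true).card : ℝ) := by
        refine Finset.sum_le_sum fun π hπ => (card_discrepancy_ge_le hn _ ε).trans ?_
        have : ((changeSet n (D π)).card : ℝ) ≤
            2 * ((changeSet n (D π)).filter fun b => b ⟨0, hn⟩ = true).card := by
          exact_mod_cast card_changeSet_le hn (hD π hπ)
        linarith
    _ ≤ 6 * Fintype.card Y := by
        rw [← Finset.mul_sum]
        gcongr
        exact_mod_cast h2

/-! ### Uniform laws on labeled and unlabeled threshold graphs -/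

theorem uniformOn_le_ofReal {Y : Type*} [Fintype Y] [Nonempty Y] [MeasurableSpace Y]
    [MeasurableSingletonClass Y] (W : Finset Y) {r K : ℝ} (hr : 0 < r)
    (h : (W.card : ℝ) * r ≤ K * Fintype.card Y) :
    uniformOn (Set.univ : Set Y) (W : Set Y) ≤ ENNReal.ofReal (K / r) := by
  rw [uniformOn_univ, Measure.count_apply_finset]
  have hY : (0 : ℝ) < Fintype.card Y := by exact_mod_cast Fintype.card_pos
  rw [← ENNReal.ofReal_natCast, ← ENNReal.ofReal_natCast, ← ENNReal.ofReal_div_of_pos hY]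
  refine ENNReal.ofReal_le_ofReal ?_
  rw [div_le_div_iff₀ hY hr]
  exact h

instance (n : ℕ) : Finite (LabeledThresholdGraph n) :=
  inferInstanceAs (Finite {G : SimpleGraph (Fin n) // IsThreshold G})

instance (n : ℕ) : Finite (UnlabeledGraph n) :=
  inferInstanceAs (Finite (Quotient (graphIsoSetoid n)))

instance (n : ℕ) : Finite (UnlabeledThresholdGraph n) :=
  inferInstanceAs (Finite {G : UnlabeledGraph n // G.IsThreshold})

instance (n : ℕ) : MeasurableSingletonClass (LabeledThresholdGraph n) := ⟨fun _ => trivial⟩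

instance (n : ℕ) : MeasurableSingletonClass (UnlabeledThresholdGraph n) := ⟨fun _ => trivial⟩

/-- The labeled threshold graph of a construction sequence. -/
def labeledBitGraph {n : ℕ} (π : Equiv.Perm (Fin n)) (b : Fin n → Bool) :
    LabeledThresholdGraph n := ⟨bitGraph π b, bitGraph_isThreshold π b⟩

/-- The unlabeled threshold graph of a construction sequence. -/
def unlabeledBitGraph {n : ℕ} (π : Equiv.Perm (Fin n)) (b : Fin n → Bool) :
    UnlabeledThresholdGraph n := ⟨toUnlabeled (bitGraph π b), bitGraph_isThreshold π b⟩

instance (n : ℕ) : Nonempty (LabeledThresholdGraph n) := ⟨labeledBitGraph 1 fun _ => true⟩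

instance (n : ℕ) : Nonempty (UnlabeledThresholdGraph n) := ⟨unlabeledBitGraph 1 fun _ => true⟩

/-- Relabeling the construction sequence. -/
def bitGraphIso {n : ℕ} (π τ : Equiv.Perm (Fin n)) (b : Fin n → Bool) :
    bitGraph π b ≃g bitGraph (τ * π) b where
  toEquiv := τ
  map_rel_iff' := by simp [bitGraph_adj, Equiv.Perm.mul_def]

theorem exists_bitGraph_of_iso {n : ℕ} {G : SimpleGraph (Fin n)} {π : Equiv.Perm (Fin n)}
    {b : Fin n → Bool} (e : bitGraph π b ≃g G) : G = bitGraph (e.toEquiv * π) b := by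
  ext u v
  obtain ⟨u, rfl⟩ := e.surjective u
  obtain ⟨v, rfl⟩ := e.surjective v
  rw [e.map_adj_iff]
  exact (bitGraphIso π e.toEquiv b).map_adj_iff.symm

theorem uniformOn_labeled_le {n : ℕ} (hn : 0 < n) {ε : ℝ} (hε : 0 < ε)
    (W : Set (LabeledThresholdGraph n))
    (hW : ∀ π b, labeledBitGraph π b ∈ W → ε ≤ discrepancy b) :
    uniformOn Set.univ W ≤ ENNReal.ofReal (6 / (ε * √n)) := by
  classical
  have := Fintype.ofFinite (LabeledThresholdGraph n)
  lift W to Finset (LabeledThresholdGraph n) using W.toFinite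
  refine uniformOn_le_ofReal W (by positivity) ?_
  -- Sortedness splits into a condition on `π` alone, at position 0, and a forced change of bit at
  -- each later descent of `π`.
  let J : Finset (Equiv.Perm (Fin n)) := Finset.univ.filter fun π =>
    ∀ h : 0 + 1 < n, π ⟨0, hn⟩ < π ⟨0 + 1, h⟩
  let D : Equiv.Perm (Fin n) → Set ℕ := fun π => {i | i ≠ 0 ∧ ∃ h : i + 1 < n,
    ¬ π ⟨i, by omega⟩ < π ⟨i + 1, h⟩}
  have hs : ∀ π b, IsSorted π b ↔ π ∈ J ∧ b ∈ changeSet n (D π) := by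
    intro π b
    simp only [J, Finset.mem_filter, Finset.mem_univ, true_and, mem_changeSet]
    refine ⟨fun h => ⟨fun h' => h 0 h' (Or.inl rfl), fun i h1 hi => ?_⟩, fun h i hi hb => ?_⟩
    · obtain ⟨h0, _, h2⟩ := hi
      have : b ⟨i, by omega⟩ ≠ b ⟨i + 1, h1⟩ := fun e => h2 (h i h1 (Or.inr e))
      exact Bool.eq_not.2 this.symm
    · rcases Nat.eq_zero_or_pos i with rfl | h0
      · exact h.1 hi
      · by_contra hc
        have h1 := h.2 i hi ⟨h0.ne', hi, hc⟩
        rw [h1] at hb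
        rcases hb with hb | hb
        · omega
        · simp at hb
  refine card_mul_le_of_discrepancy hn labeledBitGraph J D (fun π _ h => h.1 rfl) ?_ W hε ?_
  · intro π hπ τ hτ b hb c hc hb0 hc0 h
    obtain ⟨h1, h2⟩ := bitGraph_injOn ((hs π b).2 ⟨hπ, hb⟩) ((hs τ c).2 ⟨hτ, hc⟩)
      (congrArg Subtype.val h)
    refine ⟨h1, funext fun i => ?_⟩
    by_cases h0 : (i : ℕ) = 0
    · obtain rfl : i = ⟨0, hn⟩ := Fin.ext h0
      rw [hb0, hc0]
    · exact h2 i h0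
  · rintro ⟨G, hG⟩ hy
    obtain ⟨π, b, rfl⟩ := hG.exists_bitGraph
    obtain ⟨τ, hτ, e⟩ := exists_isSorted π b
    obtain ⟨h1, h2⟩ := (hs τ b).1 hτ
    exact ⟨τ, h1, b, h2, Subtype.ext e, hW π b hy⟩

/-- Every class is represented with the identity order and arbitrary bits, so nothing is forced. -/
theorem uniformOn_unlabeled_le {n : ℕ} (hn : 0 < n) {ε : ℝ} (hε : 0 < ε)
    (W : Set (UnlabeledThresholdGraph n))
    (hW : ∀ π b, unlabeledBitGraph π b ∈ W → ε ≤ discrepancy b) :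
    uniformOn Set.univ W ≤ ENNReal.ofReal (6 / (ε * √n)) := by
  classical
  have := Fintype.ofFinite (UnlabeledThresholdGraph n)
  lift W to Finset (UnlabeledThresholdGraph n) using W.toFinite
  refine uniformOn_le_ofReal W (by positivity) ?_
  refine card_mul_le_of_discrepancy hn unlabeledBitGraph {1} (fun _ => ∅) (fun π _ h => h) ?_ W hε
    ?_
  · intro π hπ τ hτ b hb c hc hb0 hc0 h
    rw [Finset.mem_singleton] at hπ hτ
    refine ⟨hπ.trans hτ.symm, funext fun i => ?_⟩
    obtain ⟨e⟩ : Nonempty (bitGraph π b ≃g bitGraph τ c) :=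
      Quotient.exact (s := graphIsoSetoid n) (congrArg Subtype.val h)
    -- Sorting rearranges labels only; the bits `b` and `c` survive, so uniqueness for labeled
    -- graphs compares them.
    obtain ⟨ρ, hρ, h1⟩ := exists_isSorted (e.toEquiv * π) b
    obtain ⟨κ, hκ, h2⟩ := exists_isSorted τ c
    obtain ⟨-, h3⟩ := bitGraph_injOn hρ hκ
      (h1.trans ((exists_bitGraph_of_iso e).symm.trans h2.symm))
    by_cases h0 : (i : ℕ) = 0
    · obtain rfl : i = ⟨0, hn⟩ := Fin.ext h0
      rw [hb0, hc0]
    · exact h3 i h0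
  · rintro ⟨G, hG⟩ hy
    induction G using Quotient.inductionOn with | h G => ?_
    obtain ⟨π, b, rfl⟩ := IsThreshold.exists_bitGraph hG
    refine ⟨1, by simp, b, by simp [mem_changeSet], Subtype.ext ?_, hW π b hy⟩
    refine Quotient.sound (s := graphIsoSetoid n) ⟨?_⟩
    simpa using bitGraphIso 1 π b


/-! ### Empirical measures and their convergence to the uniform distribution -/

/-- The empirical distribution of a family of points of the unit interval. -/
def empirical {n : ℕ+} (x : Fin n → I) : ProbabilityMeasure I :=
  ⟨((n : ℕ) : ENNReal)⁻¹ • ∑ v : Fin n, Measure.dirac (x v), ⟨by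
    have h0 : ((n : ℕ) : ENNReal) ≠ 0 := by simp
    simp [ENNReal.inv_mul_cancel h0 (ENNReal.natCast_ne_top _)]⟩⟩

theorem degreeDistribution_eq_empirical {n : ℕ+} (G : SimpleGraph (Fin n)) :
    degreeDistribution G = empirical (normalizedDegree G) := rfl

theorem integral_empirical {n : ℕ+} (x : Fin n → I) (g : I → ℝ) :
    ∫ y, g y ∂(empirical x : Measure I) = (∑ v, g (x v)) / (n : ℕ) := by
  change ∫ y, g y ∂(((n : ℕ) : ENNReal)⁻¹ • ∑ v : Fin n, Measure.dirac (x v)) = _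
  rw [integral_smul_measure, integral_finsetSum_measure fun v _ => integrable_dirac (by simp)]
  simp [integral_dirac, div_eq_inv_mul]

theorem abs_sub_integral_cell_le {g : ℝ → ℝ} {L : NNReal} (hg : LipschitzWith L g) {a c d : ℝ}
    (hac : a ≤ c) (hca : c ≤ a + d) :
    |g c * d - ∫ x in a..(a + d), g x| ≤ L * d * d := by
  have hd : 0 ≤ d := by linarith
  have e : g c * d - ∫ x in a..(a + d), g x = ∫ x in a..(a + d), (g c - g x) := by
    rw [intervalIntegral.integral_sub intervalIntegrable_const (hg.continuous.intervalIntegrable _ _)]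
    simp [mul_comm]
  rw [e]
  have := intervalIntegral.norm_integral_le_of_norm_le_const (a := a) (b := a + d) (C := L * d)
    (f := fun x => g c - g x) fun x hx => by
      rw [Set.uIoc_of_le (by linarith)] at hx
      rw [← dist_eq_norm]
      refine (hg.dist_le_mul c x).trans ?_
      gcongr
      rw [Real.dist_eq, abs_le]
      constructor <;> linarith [hx.1, hx.2]
  simpa [abs_of_nonneg hd] using this

theorem sum_range_two_mul (F : ℕ → ℝ) (n : ℕ) :
    ∑ k ∈ Finset.range (2 * n), F k = ∑ i ∈ Finset.range n, (F (n + i) + F (n - 1 - i)) := by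
  rw [two_mul, Finset.sum_range_add, Finset.sum_add_distrib, Finset.sum_range_reflect, add_comm]

/-- A Riemann sum for `∫ g` on `[0,1]` that is symmetric about the midpoint. -/
theorem abs_riemannSum_sub_integral_le {g : ℝ → ℝ} {L : NNReal} (hg : LipschitzWith L g) {n : ℕ}
    (hn : 0 < n) :
    |(∑ i ∈ Finset.range n, (g (1 / 2 + (i + 1) / (2 * n)) + g (1 / 2 - (i + 1) / (2 * n))) / 2) / n
      - ∫ x in (0 : ℝ)..1, g x| ≤ L / n := by
  have hn' : (0 : ℝ) < n := by exact_mod_cast hn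
  set d : ℝ := 1 / (2 * n) with hd
  -- The `2 * n` cells of width `d` are paired about 1/2: the sample points are the right end of
  -- cell `n + i` and the left end of cell `n - 1 - i`.
  have hsum : ∫ x in (0 : ℝ)..1, g x =
      ∑ i ∈ Finset.range n, ((∫ x in (((n + i : ℕ) : ℝ) * d)..(((n + i : ℕ) : ℝ) * d + d), g x) +
        ∫ x in (((n - 1 - i : ℕ) : ℝ) * d)..(((n - 1 - i : ℕ) : ℝ) * d + d), g x) := by
    rw [← sum_range_two_mul (fun k => ∫ x in ((k : ℝ) * d)..((k : ℝ) * d + d), g x)]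
    have := intervalIntegral.sum_integral_adjacent_intervals (f := g) (μ := volume)
      (a := fun k : ℕ => (k : ℝ) * d) (n := 2 * n)
      fun k _ => hg.continuous.intervalIntegrable _ _
    have e1 : ((2 * n : ℕ) : ℝ) * d = 1 := by rw [hd]; push_cast; field_simp
    simp only [e1, Nat.cast_zero, zero_mul] at this
    rw [← this]
    refine Finset.sum_congr rfl fun k _ => ?_
    congr 1
    push_cast; ring
  rw [hsum, Finset.sum_div, ← Finset.sum_sub_distrib]
  calc _ ≤ ∑ i ∈ Finset.range n, (2 * (L * d * d) : ℝ) := by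
        refine (Finset.abs_sum_le_sum_abs _ _).trans (Finset.sum_le_sum fun i hi => ?_)
        have hi' : i < n := Finset.mem_range.1 hi
        have hd0 : 0 < d := by rw [hd]; positivity
        have ea : (1 / 2 + (i + 1) / (2 * n) : ℝ) = ((n + i : ℕ) : ℝ) * d + d := by
          rw [hd]; push_cast; field_simp; ring
        have eb : (1 / 2 - (i + 1) / (2 * n) : ℝ) = ((n - 1 - i : ℕ) : ℝ) * d := by
          rw [hd, Nat.sub_sub, Nat.cast_sub (by omega)]; push_cast; field_simp; ring
        have h1 := abs_sub_integral_cell_le hg (a := ((n + i : ℕ) : ℝ) * d) (d := d)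
          (by linarith) le_rfl
        have h2 := abs_sub_integral_cell_le hg (a := ((n - 1 - i : ℕ) : ℝ) * d) (d := d) le_rfl
          (by linarith)
        rw [ea, eb, two_mul]
        refine le_trans (le_of_eq ?_) ((abs_add_le _ _).trans (add_le_add h1 h2))
        congr 1
        have e : ∀ y : ℝ, y / 2 / n = y * d := fun y => by rw [hd]; field_simp
        rw [e]; ring
    _ ≤ L / n := by
        rw [Finset.sum_const, Finset.card_range, nsmul_eq_mul, hd]
        have : (n : ℝ) * (2 * (L * (1 / (2 * n)) * (1 / (2 * n)))) = (L / n) / 2 := by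
          field_simp
        rw [this]
        have : (0 : ℝ) ≤ L / n := by positivity
        linarith

/-- Abel summation, which moves the oscillation into the partial sums; the two terms of
`discrepancy` bound its boundary and bulk parts. -/
theorem sum_signSeq_mul {n : ℕ} (b : Fin n → Bool) (h : ℕ → ℝ) (m : ℕ) :
    ∑ i ∈ Finset.range m, signSeq b i * h i =
      signSum b m * h m - ∑ i ∈ Finset.range m, signSum b (i + 1) * (h (i + 1) - h i) := by
  induction m with
  | zero => simp
  | succ m ih =>
    rw [Finset.sum_range_succ, ih, Finset.sum_range_succ, signSum_succ]
    ring

theorem sum_abs_signSum_succ {n : ℕ} (b : Fin n → Bool) :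
    ∑ i ∈ Finset.range n, |signSum b (i + 1)| = ∑ m ∈ Finset.range (n + 1), |signSum b m| := by
  rw [Finset.sum_range_succ']; simp

theorem abs_sum_signSeq_mul_le {n : ℕ} (hn : 0 < n) (b : Fin n → Bool) {h : ℕ → ℝ} {K : ℝ}
    (h1 : |h n| ≤ K) (h2 : ∀ i < n, |h (i + 1) - h i| ≤ K / n) :
    |(∑ i ∈ Finset.range n, signSeq b i * h i) / n| ≤ K * discrepancy b := by
  have hn' : (0 : ℝ) < n := by exact_mod_cast hn
  rw [sum_signSeq_mul, abs_div, Nat.abs_cast, div_le_iff₀ hn']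
  calc _ ≤ |signSum b n| * K + ∑ i ∈ Finset.range n, |signSum b (i + 1)| * (K / n) := by
        refine (abs_sub _ _).trans (add_le_add ?_ ?_)
        · rw [abs_mul]; gcongr
        · refine (Finset.abs_sum_le_sum_abs _ _).trans (Finset.sum_le_sum fun i hi => ?_)
          rw [abs_mul]
          gcongr
          exact h2 i (Finset.mem_range.1 hi)
    _ = K * discrepancy b * n := by
        rw [← Finset.sum_mul, sum_abs_signSum_succ, discrepancy]
        field_simp
        ring

/-- The position in `[0,1]` of a vertex of `bitGraph π b`. -/
def bitPosition {n : ℕ} (π : Equiv.Perm (Fin n)) (b : Fin n → Bool) (v : Fin n) : I :=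
  ⟨1 / 2 + bitSign (b (π.symm v)) * ((((π.symm v : ℕ) : ℝ) + 1) / (2 * n)), by
    have h1 : (((π.symm v : ℕ) : ℝ) + 1) ≤ n := by exact_mod_cast (π.symm v).2
    have hn : (0 : ℝ) < n := lt_of_lt_of_le (by positivity) h1
    have h2 : (((π.symm v : ℕ) : ℝ) + 1) / (2 * n) ≤ 1 / 2 := by
      rw [div_le_div_iff₀ (by positivity) (by norm_num)]; linarith
    have h3 : 0 ≤ (((π.symm v : ℕ) : ℝ) + 1) / (2 * n) := by positivity
    cases b (π.symm v) <;> simp only [bitSign_true, bitSign_false, Set.mem_Icc] <;>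
      constructor <;> linarith⟩

theorem integral_uniform_eq (g : I → ℝ) :
    ∫ y, g y ∂(uniformUnitInterval : Measure I) =
      ∫ x in (0 : ℝ)..1, g (Set.projIcc 0 1 zero_le_one x) := by
  rw [intervalIntegral.integral_of_le zero_le_one, ← integral_Icc_eq_integral_Ioc,
    ← integral_subtype measurableSet_Icc fun x => g (Set.projIcc 0 1 zero_le_one x)]
  simp only [Set.projIcc_val]
  rfl

theorem abs_integral_bitPosition_sub_le {n : ℕ+} (π : Equiv.Perm (Fin n)) (b : Fin n → Bool)
    {g : I → ℝ} {L : NNReal} (hg : LipschitzWith L g) :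
    |(∑ v, g (bitPosition π b v)) / (n : ℕ) - ∫ y, g y ∂(uniformUnitInterval : Measure I)| ≤
      L * (discrepancy b + 1 / (n : ℕ)) := by
  have hn' : (0 : ℝ) < (n : ℕ) := by exact_mod_cast n.pos
  have hn1 : (1 : ℝ) ≤ (n : ℕ) := by exact_mod_cast n.pos
  set f : ℝ → ℝ := fun x => g (Set.projIcc 0 1 zero_le_one x) with hf
  have hfL : LipschitzWith L f := by
    simpa using! hg.comp (LipschitzWith.projIcc (zero_le_one (α := ℝ)))
  -- Split `f` into its even and odd parts about 1/2. The even part gives a symmetric Riemann sum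
  -- whatever the bits; the signs multiply only the odd part `h`.
  set h : ℕ → ℝ := fun i =>
    (f (1 / 2 + (i + 1) / (2 * (n : ℕ))) - f (1 / 2 - (i + 1) / (2 * (n : ℕ)))) / 2 with hh
  have e : ∑ v, g (bitPosition π b v) =
      ∑ i ∈ Finset.range n, (f (1 / 2 + (i + 1) / (2 * (n : ℕ))) +
        f (1 / 2 - (i + 1) / (2 * (n : ℕ)))) / 2 + ∑ i ∈ Finset.range n, signSeq b i * h i := by
    rw [← Equiv.sum_comp π, ← Finset.sum_add_distrib, ← Fin.sum_univ_eq_sum_range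
      (fun i => (f (1 / 2 + (i + 1) / (2 * (n : ℕ))) +
        f (1 / 2 - (i + 1) / (2 * (n : ℕ)))) / 2 + signSeq b i * h i)]
    refine Finset.sum_congr rfl fun i _ => ?_
    have : g (bitPosition π b (π i)) = f (1 / 2 + bitSign (b i) * (((i : ℕ) + 1) / (2 * (n : ℕ)))) := by
      rw [hf]
      change _ = g (Set.projIcc 0 1 zero_le_one _)
      rw [← Set.projIcc_val zero_le_one (bitPosition π b (π i))]
      simp [bitPosition]
    rw [this, signSeq_of_lt b i.2, hh]
    cases b i <;> simp only [bitSign_true, bitSign_false, one_mul, neg_mul, ← sub_eq_add_neg] <;> ring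
  rw [e, integral_uniform_eq, add_div, add_sub_right_comm]
  have h1 := abs_riemannSum_sub_integral_le hfL n.pos
  have hlip : ∀ x y, |f x - f y| ≤ L * |x - y| := fun x y => hfL.dist_le_mul x y
  have h2 := abs_sum_signSeq_mul_le n.pos b (h := h) (K := L)
    (by
      -- At index `n` the arguments leave [0,1], harmlessly, since `f` extends `g` by constants.
      have := hlip (1 / 2 + ((n : ℕ) + 1) / (2 * (n : ℕ))) (1 / 2 - ((n : ℕ) + 1) / (2 * (n : ℕ)))
      have e0 : (1 / 2 + ((n : ℕ) + 1) / (2 * (n : ℕ)) - (1 / 2 - ((n : ℕ) + 1) / (2 * (n : ℕ))) : ℝ)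
        = 1 + 1 / (n : ℕ) := by field_simp; ring
      have e1 : (1 / (n : ℕ) : ℝ) ≤ 1 := by rw [div_le_one hn']; exact hn1
      rw [e0, abs_of_nonneg (show (0 : ℝ) ≤ 1 + 1 / (n : ℕ) by positivity)] at this
      rw [hh, abs_div, abs_two, div_le_iff₀ two_pos]
      refine this.trans ?_
      gcongr
      linarith)
    (by
      intro i _
      have a1 := hlip (1 / 2 + ((i + 1 : ℕ) + 1) / (2 * (n : ℕ))) (1 / 2 + (i + 1) / (2 * (n : ℕ)))
      have a2 := hlip (1 / 2 - ((i + 1 : ℕ) + 1) / (2 * (n : ℕ))) (1 / 2 - (i + 1) / (2 * (n : ℕ)))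
      have e1 : (1 / 2 + ((i + 1 : ℕ) + 1) / (2 * (n : ℕ)) - (1 / 2 + (i + 1) / (2 * (n : ℕ))) : ℝ)
        = 1 / (2 * (n : ℕ)) := by push_cast; ring
      have e2 : (1 / 2 - ((i + 1 : ℕ) + 1) / (2 * (n : ℕ)) - (1 / 2 - (i + 1) / (2 * (n : ℕ))) : ℝ)
        = -(1 / (2 * (n : ℕ))) := by push_cast; ring
      have e5 : (0 : ℝ) ≤ 1 / (2 * (n : ℕ)) := by positivity
      rw [e1, abs_of_nonneg e5] at a1
      rw [e2, abs_neg, abs_of_nonneg e5] at a2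
      have e3 : (L : ℝ) / (n : ℕ) = L * (1 / (2 * (n : ℕ))) + L * (1 / (2 * (n : ℕ))) := by
        field_simp; norm_num
      have e4 : (0 : ℝ) ≤ L * (1 / (2 * (n : ℕ))) := by positivity
      rw [e3, hh, abs_le]
      rw [abs_le] at a1 a2
      constructor <;> linarith [a1.1, a1.2, a2.1, a2.2])
  calc _ ≤ _ := abs_add_le _ _
    _ ≤ L / (n : ℕ) + L * discrepancy b := add_le_add h1 h2
    _ = _ := by ring

/-- The `i` earlier vertices are all or none of them neighbours, according to `b i`; each later
vertex `j` contributes (1 + sign of `b j`)/2. -/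
theorem degree_bitGraph {n : ℕ} (π : Equiv.Perm (Fin n)) (b : Fin n → Bool) (i : Fin n)
    [Fintype ((bitGraph π b).neighborSet (π i))] :
    ((bitGraph π b).degree (π i) : ℝ) =
      (n - 1 + i * bitSign (b i) + signSum b n - signSum b (i + 1)) / 2 := by
  classical
  let ψ : ℕ → ℝ := fun j =>
    if j < i then (1 + signSeq b i) / 2 else if j = i then 0 else (1 + signSeq b j) / 2
  have h1 : ((bitGraph π b).degree (π i) : ℝ) = ∑ j ∈ Finset.range n, ψ j := by
    rw [← SimpleGraph.card_neighborFinset_eq_degree, ← Fin.sum_univ_eq_sum_range]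
    have : (bitGraph π b).neighborFinset (π i) =
        Finset.univ.filter fun v => (bitGraph π b).Adj (π i) v := by ext; simp
    rw [this, ← Finset.sum_boole, ← Equiv.sum_comp π]
    refine Finset.sum_congr rfl fun j _ => ?_
    simp only [bitGraph_adj, Equiv.symm_apply_apply, ψ, ne_eq, π.injective.eq_iff]
    rcases lt_trichotomy j i with h | rfl | h
    · rw [max_eq_left h.le, if_pos (Fin.lt_def.1 h), signSeq_of_lt b i.2]
      cases b i <;> simp [h.ne']
    · simp
    · have h' : (i : ℕ) < j := h
      rw [max_eq_right h.le, if_neg (c := (j : ℕ) < i) (by omega),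
        if_neg (c := (j : ℕ) = i) (by omega), signSeq_of_lt b j.2]
      cases b j <;> simp [h.ne]
  have h2 : ∀ m, (i : ℕ) + 1 ≤ m → ∑ j ∈ Finset.range m, ψ j =
      (m - 1 + i * signSeq b i + signSum b m - signSum b (i + 1)) / 2 := by
    intro m hm
    induction m, hm using Nat.le_induction with
    | base =>
      have : ∑ j ∈ Finset.range (i : ℕ), ψ j = ∑ j ∈ Finset.range (i : ℕ), (1 + signSeq b i) / 2 :=
        Finset.sum_congr rfl fun j hj => if_pos (Finset.mem_range.1 hj)
      rw [Finset.sum_range_succ, this]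
      simp [ψ]
      ring
    | succ m hm ih =>
      rw [Finset.sum_range_succ, ih, signSum_succ b m]
      have : ψ m = (1 + signSeq b m) / 2 := by
        simp only [ψ]; rw [if_neg (by omega), if_neg (by omega)]
      rw [this]
      push_cast
      ring
  rw [h1, h2 n i.2, signSeq_of_lt b i.2]

theorem abs_normalizedDegree_sub_le {n : ℕ+} (π : Equiv.Perm (Fin n)) (b : Fin n → Bool)
    (i : Fin n) : |(normalizedDegree (bitGraph π b) (π i) : ℝ) - bitPosition π b (π i)| ≤
      (2 + |signSum b n| + |signSum b (i + 1)|) / (2 * (n : ℕ)) := by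
  have hn' : (0 : ℝ) < (n : ℕ) := by exact_mod_cast n.pos
  have e : (normalizedDegree (bitGraph π b) (π i) : ℝ) - bitPosition π b (π i) =
      (signSum b n - signSum b (i + 1) - (1 + bitSign (b i))) / (2 * (n : ℕ)) := by
    simp only [normalizedDegree, bitPosition, degree_bitGraph, Equiv.symm_apply_apply]
    field_simp
    ring
  rw [e, abs_div, abs_of_pos (a := 2 * ((n : ℕ) : ℝ)) (by positivity)]
  gcongr
  have h1 : |1 + bitSign (b i)| ≤ 2 := by cases b i <;> norm_num
  calc _ ≤ |signSum b n - signSum b (i + 1)| + |1 + bitSign (b i)| := abs_sub _ _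
    _ ≤ |signSum b n| + |signSum b (i + 1)| + 2 := add_le_add (abs_sub _ _) h1
    _ = _ := by ring

theorem abs_integral_degree_sub_le {n : ℕ+} (π : Equiv.Perm (Fin n)) (b : Fin n → Bool)
    {g : I → ℝ} {L : NNReal} (hg : LipschitzWith L g) :
    |(∑ v, g (normalizedDegree (bitGraph π b) v)) / (n : ℕ) -
      (∑ v, g (bitPosition π b v)) / (n : ℕ)| ≤ L * (discrepancy b + 1 / (n : ℕ)) := by
  have hn' : (0 : ℝ) < (n : ℕ) := by exact_mod_cast n.pos
  rw [← sub_div, ← Equiv.sum_comp π, ← Equiv.sum_comp π fun v => g (bitPosition π b v),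
    ← Finset.sum_sub_distrib, abs_div, Nat.abs_cast, div_le_iff₀ hn']
  calc _ ≤ ∑ i : Fin n, L * ((2 + |signSum b n| + |signSum b (i + 1)|) / (2 * (n : ℕ))) := by
        refine (Finset.abs_sum_le_sum_abs _ _).trans (Finset.sum_le_sum fun i _ => ?_)
        refine (hg.dist_le_mul _ _).trans ?_
        gcongr
        exact abs_normalizedDegree_sub_le π b i
    _ = ∑ i ∈ Finset.range n,
          L * ((2 + |signSum b n| + |signSum b (i + 1)|) / (2 * (n : ℕ))) :=
        Fin.sum_univ_eq_sum_range
          (fun i => (L : ℝ) * ((2 + |signSum b n| + |signSum b (i + 1)|) / (2 * (n : ℕ)))) n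
    _ = L * (1 + |signSum b n| / 2 +
          (∑ m ∈ Finset.range ((n : ℕ) + 1), |signSum b m|) / (2 * (n : ℕ))) := by
        rw [← Finset.mul_sum, ← Finset.sum_div, Finset.sum_add_distrib, sum_abs_signSum_succ,
          Finset.sum_const, Finset.card_range, nsmul_eq_mul]
        field_simp
    _ ≤ L * (1 + |signSum b n| +
          (∑ m ∈ Finset.range ((n : ℕ) + 1), |signSum b m|) / (n : ℕ)) := by
        have h0 : 0 ≤ ∑ m ∈ Finset.range ((n : ℕ) + 1), |signSum b m| := by positivity
        gcongr
        · linarith [abs_nonneg (signSum b n)]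
        · linarith
    _ = _ := by
        rw [discrepancy]
        field_simp
        ring

/-- Lipschitz test functions suffice for weak convergence. -/
theorem tendsto_uniform_of_lipschitz {α : Type*} {l : Filter α} [l.IsCountablyGenerated]
    {μ : α → ProbabilityMeasure I} {r : α → ℝ} (hr : Tendsto r l (𝓝 0))
    (h : ∀ (g : I → ℝ) (L : NNReal), LipschitzWith L g → ∀ a,
      |∫ y, g y ∂(μ a : Measure I) - ∫ y, g y ∂(uniformUnitInterval : Measure I)| ≤ L * r a) :
    Tendsto μ l (𝓝 uniformUnitInterval) := by
  rw [tendsto_iff_forall_lipschitz_integral_tendsto]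
  rintro g - ⟨L, hL⟩
  rw [tendsto_iff_dist_tendsto_zero]
  refine squeeze_zero (fun _ => dist_nonneg) (h g L hL) ?_
  simpa using hr.const_mul (L : ℝ)

/-! ### Equidistribution as the discrepancy tends to zero -/

section Limits

variable {α : Type*} {l : Filter α} {N : α → ℕ+}
  {π : ∀ a, Equiv.Perm (Fin (N a))} {b : ∀ a, Fin (N a) → Bool}

theorem tendsto_one_div_order (hN : Tendsto N l atTop) :
    Tendsto (fun a => 1 / ((N a : ℕ) : ℝ)) l (𝓝 0) := by
  have : Tendsto (fun a => (N a : ℕ)) l atTop := (tendsto_PNat_val_atTop_atTop).comp hN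
  exact tendsto_one_div_atTop_nhds_zero_nat.comp this

theorem tendsto_empirical_bitPosition [l.IsCountablyGenerated] (hN : Tendsto N l atTop)
    (hb : Tendsto (fun a => discrepancy (b a)) l (𝓝 0)) :
    Tendsto (fun a => empirical (bitPosition (π a) (b a))) l (𝓝 uniformUnitInterval) := by
  refine tendsto_uniform_of_lipschitz (r := fun a => discrepancy (b a) + 1 / ((N a : ℕ) : ℝ)) ?_
    fun g L hg a => ?_
  · simpa using hb.add (tendsto_one_div_order hN)
  · rw [integral_empirical]
    exact abs_integral_bitPosition_sub_le (π a) (b a) hg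

theorem tendsto_degreeDistribution_bitGraph [l.IsCountablyGenerated]
    (hN : Tendsto N l atTop)
    (hb : Tendsto (fun a => discrepancy (b a)) l (𝓝 0)) :
    Tendsto (fun a => degreeDistribution (bitGraph (π a) (b a))) l (𝓝 uniformUnitInterval) := by
  refine tendsto_uniform_of_lipschitz
    (r := fun a => 2 * (discrepancy (b a) + 1 / ((N a : ℕ) : ℝ))) ?_ fun g L hg a => ?_
  · simpa using (hb.add (tendsto_one_div_order hN)).const_mul 2
  · rw [degreeDistribution_eq_empirical, integral_empirical]
    have h1 := abs_integral_bitPosition_sub_le (π a) (b a) hg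
    have h2 := abs_integral_degree_sub_le (π a) (b a) hg
    refine (abs_sub_le _ _ _).trans ((add_le_add h2 h1).trans (le_of_eq ?_))
    ring

end Limits


/-! ### Homomorphism densities of threshold graphs -/

/-- Independent samples from the points amount to a uniformly random map of indices; this is what
turns homomorphism counts into product measures. -/
theorem pi_empirical {n : ℕ+} (x : Fin n → I) (k : ℕ) :
    Measure.pi (fun _ : Fin k => (empirical x : Measure I)) =
      (((n : ℕ) : ENNReal) ^ k)⁻¹ • ∑ φ : Fin k → Fin n, Measure.dirac (x ∘ φ) := by
  classical
  refine Measure.pi_eq fun s hs => ?_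
  have e : ∀ i : Fin k, (empirical x : Measure I) (s i) =
      ((n : ℕ) : ENNReal)⁻¹ * ∑ v : Fin n, (s i).indicator 1 (x v) := by
    intro i
    change (((n : ℕ) : ENNReal)⁻¹ • ∑ v : Fin n, Measure.dirac (x v)) (s i) = _
    simp [Measure.dirac_apply' _ (hs i)]
  simp only [e, Finset.prod_mul_distrib, Finset.prod_const, Finset.card_univ, Fintype.card_fin,
    Finset.prod_univ_sum, Fintype.piFinset_univ, ENNReal.inv_pow]
  rw [Measure.smul_apply, Measure.finsetSum_apply, smul_eq_mul]
  congr 1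
  refine Finset.sum_congr rfl fun φ _ => ?_
  rw [Measure.dirac_apply' _ (MeasurableSet.univ_pi hs)]
  by_cases h : ∀ i, x (φ i) ∈ s i
  · rw [Set.indicator_of_mem (by simpa using h)]
    exact (Finset.prod_eq_one fun i _ => Set.indicator_of_mem (h i) _).symm
  · rw [Set.indicator_of_notMem (by simpa using h)]
    push Not at h
    obtain ⟨i, hi⟩ := h
    exact (Finset.prod_eq_zero (Finset.mem_univ i) (Set.indicator_of_notMem hi _)).symm

theorem pi_empirical_apply {n : ℕ+} (x : Fin n → I) {k : ℕ} {E : Set (Fin k → I)}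
    (hE : MeasurableSet E) [DecidablePred fun φ : Fin k → Fin n => x ∘ φ ∈ E] :
    (Measure.pi fun _ : Fin k => (empirical x : Measure I)).real E =
      ((Finset.univ.filter fun φ : Fin k → Fin n => x ∘ φ ∈ E).card : ℝ) / (n : ℕ) ^ k := by
  rw [pi_empirical, measureReal_ennreal_smul_apply, Measure.real, Measure.finsetSum_apply]
  have : ∑ φ : Fin k → Fin n, (Measure.dirac (x ∘ φ)) E =
      ((Finset.univ.filter fun φ : Fin k → Fin n => x ∘ φ ∈ E).card : ENNReal) := by
    rw [← Finset.sum_boole]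
    exact Finset.sum_congr rfl fun φ _ => by rw [Measure.dirac_apply' _ hE, Set.indicator_apply]; rfl
  rw [this]
  simp [div_eq_inv_mul]

open Classical in
theorem homDensity_eq_card {k n : ℕ} (F : SimpleGraph (Fin k)) (G : SimpleGraph (Fin n)) :
    homDensity F G = ((Finset.univ.filter fun φ : Fin k → Fin n =>
      ∀ i j, F.Adj i j → G.Adj (φ i) (φ j)).card : ℝ) / (n : ℝ) ^ k := by
  unfold homDensity
  congr 1
  · rw [← Fintype.card_subtype, ← Nat.card_eq_fintype_card]
    congr 1
    exact Nat.card_congr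
      { toFun := fun f => ⟨f, fun i j h => f.map_adj h⟩
        invFun := fun φ => ⟨φ.1, fun h => φ.2 _ _ h⟩
        left_inv := fun _ => rfl
        right_inv := fun _ => rfl }
  · simp [Nat.card_eq_fintype_card]

/-- The points whose coordinates define a strict homomorphism from `F` to the threshold graphon. -/
def homRegion {k : ℕ} (F : SimpleGraph (Fin k)) : Set (Fin k → I) :=
  {y | ∀ i j, F.Adj i j → (1 : ℝ) < y i + y j ∧ y i ≠ y j}

theorem isOpen_homRegion {k : ℕ} (F : SimpleGraph (Fin k)) : IsOpen (homRegion F) := by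
  simp only [homRegion, Set.ofPred_forall]
  refine isOpen_iInter_of_finite fun i => isOpen_iInter_of_finite fun j =>
    isOpen_iInter_of_finite fun _ => IsOpen.and ?_ ?_
  · exact isOpen_lt (by fun_prop) (by fun_prop)
  · exact isOpen_ne_fun (by fun_prop) (by fun_prop)

/-- The degenerate points: some edge of `F` lies on the boundary or on the diagonal. -/
def homBoundary {k : ℕ} (F : SimpleGraph (Fin k)) : Set (Fin k → I) :=
  ⋃ (i : Fin k) (j : Fin k) (_ : F.Adj i j), ({y | (y i : ℝ) + y j = 1} ∪ {y | y i = y j})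

/-- Two coordinates are independent and uniform, and each slice of the graph of `f` is a single
point. -/
theorem volume_graph_eq_zero {k : ℕ} {i j : Fin k} (hij : i ≠ j) (f : I → I) (hf : Measurable f) :
    volume {y : Fin k → I | y i = f (y j)} = 0 := by
  have hind : IndepFun (fun y : Fin k → I => y i) (fun y : Fin k → I => y j)
      (Measure.pi fun _ => (volume : Measure I)) :=
    (iIndepFun_pi (X := fun _ : Fin k => (id : I → I)) fun _ => aemeasurable_id).indepFun hij
  rw [indepFun_iff_map_prod_eq_prod_map_map (measurable_pi_apply i).aemeasurable
    (measurable_pi_apply j).aemeasurable] at hind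
  have h1 := (measurePreserving_eval (fun _ : Fin k => (volume : Measure I)) i).map_eq
  have h2 := (measurePreserving_eval (fun _ : Fin k => (volume : Measure I)) j).map_eq
  change Measure.map (fun y : Fin k → I => y i) _ = _ at h1
  change Measure.map (fun y : Fin k → I => y j) _ = _ at h2
  rw [h1, h2] at hind
  have hm : MeasurableSet {p : I × I | p.1 = f p.2} :=
    measurableSet_eq_fun measurable_fst (hf.comp measurable_snd)
  have : volume {y : Fin k → I | y i = f (y j)} =
      (Measure.pi fun _ : Fin k => (volume : Measure I)).map (fun y => (y i, y j))
        {p : I × I | p.1 = f p.2} := by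
    rw [Measure.map_apply (by fun_prop) hm]
    rfl
  rw [this, hind, Measure.prod_apply_symm hm]
  simp

theorem volume_homBoundary {k : ℕ} (F : SimpleGraph (Fin k)) : volume (homBoundary F) = 0 := by
  refine measure_iUnion_null fun i => measure_iUnion_null fun j => measure_iUnion_null fun h =>
    measure_union_null ?_ (volume_graph_eq_zero h.ne id measurable_id)
  refine measure_mono_null (fun y hy => ?_)
    (volume_graph_eq_zero h.ne unitInterval.symm unitInterval.continuous_symm.measurable)
  have hy' : (y i : ℝ) + y j = 1 := hy
  exact Subtype.ext (by rw [unitInterval.coe_symm_eq]; linarith)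

theorem mem_homRegion_of_le {k : ℕ} {F : SimpleGraph (Fin k)} {y : Fin k → I}
    (h : ∀ i j, F.Adj i j → (1 : ℝ) ≤ y i + y j) (hy : y ∉ homBoundary F) : y ∈ homRegion F := by
  simp only [homBoundary, Set.mem_iUnion, not_exists, Set.mem_union, not_or] at hy
  intro i j hij
  exact ⟨lt_of_le_of_ne (h i j hij) (Ne.symm (hy i j hij).1), (hy i j hij).2⟩

/-- Points of the closure satisfy the weak inequalities; off the null set `homBoundary F` these are
strict and the coordinates along edges differ. -/
theorem volume_frontier_homRegion {k : ℕ} (F : SimpleGraph (Fin k)) :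
    volume (frontier (homRegion F)) = 0 := by
  refine measure_mono_null (fun y hy => ?_) (volume_homBoundary F)
  rw [(isOpen_homRegion F).frontier_eq] at hy
  have hcl : IsClosed {y : Fin k → I | ∀ i j, F.Adj i j → (1 : ℝ) ≤ y i + y j} := by
    simp only [Set.ofPred_forall]
    exact isClosed_iInter fun i => isClosed_iInter fun j => isClosed_iInter fun _ =>
      isClosed_le (by fun_prop) (by fun_prop)
  have hsub : closure (homRegion F) ⊆ _ :=
    closure_minimal (fun y hy i j hij => (hy i j hij).1.le) hcl
  by_contra hb
  exact hy.2 (mem_homRegion_of_le (hsub hy.1) hb)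

/-- The weak inequality in W_λ and its nonzero diagonal matter only on a null set. -/
theorem thresholdGraphon_homDensity {k : ℕ} (F : SimpleGraph (Fin k)) :
    (thresholdGraphon uniformUnitInterval uniform_isReflectionInvariant).homDensity F =
      (volume : Measure (Fin k → I)).real (homRegion F) := by
  classical
  unfold Graphon.homDensity
  rw [← integral_indicator_one (isOpen_homRegion F).measurableSet]
  refine integral_congr_ae ?_
  filter_upwards [measure_eq_zero_iff_ae_notMem.1 (volume_homBoundary F)] with y hy
  have hW : ∀ a c : I, ((thresholdGraphon uniformUnitInterval
      uniform_isReflectionInvariant).toFun a c : ℝ) = if (1 : ℝ) ≤ a + c then 1 else 0 := by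
    intro a c
    simp only [thresholdGraphon, mem_thresholdSet_uniform]
    split_ifs <;> rfl
  simp only [hW]
  rw [Set.indicator_apply]
  split_ifs with h
  · refine Finset.prod_eq_one fun p hp => if_pos ?_
    exact (h _ _ (Finset.mem_filter.1 hp).2.2).1.le
  · have : ∃ i j, F.Adj i j ∧ ¬ (1 : ℝ) ≤ y i + y j := by
      by_contra! hc
      exact h (mem_homRegion_of_le hc hy)
    obtain ⟨i, j, hij, hlt⟩ := this
    -- The product lists each edge only with its smaller endpoint first.
    wlog hlt' : i < j generalizing i j
    · exact this j i hij.symm (by rwa [add_comm]) (lt_of_le_of_ne (not_lt.1 hlt') hij.ne')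
    exact Finset.prod_eq_zero (i := (i, j)) (by simp [hlt', hij]) (if_neg hlt)

theorem bitPosition_injective {n : ℕ} (π : Equiv.Perm (Fin n)) (b : Fin n → Bool) :
    Function.Injective (bitPosition π b) := by
  intro u v h
  have hn : (0 : ℝ) < n := by exact_mod_cast u.pos
  have h1 : bitSign (b (π.symm u)) * (((π.symm u : ℕ) : ℝ) + 1) =
      bitSign (b (π.symm v)) * (((π.symm v : ℕ) : ℝ) + 1) := by
    have := congrArg Subtype.val h
    simp only [bitPosition] at this
    field_simp at this
    linarith
  have hu : (0 : ℝ) < ((π.symm u : ℕ) : ℝ) + 1 := by positivity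
  have hv : (0 : ℝ) < ((π.symm v : ℕ) : ℝ) + 1 := by positivity
  have h2 : ((π.symm u : ℕ) : ℝ) = (π.symm v : ℕ) := by
    cases hbu : b (π.symm u) <;> cases hbv : b (π.symm v) <;>
      simp only [hbu, hbv, bitSign_true, bitSign_false] at h1 <;> linarith
  exact π.symm.injective (Fin.ext (by exact_mod_cast h2))

/-- The position is an affine image of the signed weight. The inequality of positions excludes
loops: a single point above 1/2 already has sum with itself exceeding 1. -/
theorem bitGraph_adj_iff_bitPosition {n : ℕ} (π : Equiv.Perm (Fin n)) (b : Fin n → Bool)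
    (u v : Fin n) : (bitGraph π b).Adj u v ↔
      (1 : ℝ) < bitPosition π b u + bitPosition π b v ∧ bitPosition π b u ≠ bitPosition π b v := by
  rw [(bitPosition_injective π b).ne_iff]
  by_cases h : u = v
  · simp [h]
  have hn : (0 : ℝ) < n := by exact_mod_cast u.pos
  rw [bitGraph_adj_iff_weights h]
  simp only [ne_eq, h, not_false_eq_true, and_true]
  have : (bitPosition π b u + bitPosition π b v : ℝ) = 1 +
      (bitSign (b (π.symm u)) * (((π.symm u : ℕ) : ℝ) + 1) +
        bitSign (b (π.symm v)) * (((π.symm v : ℕ) : ℝ) + 1)) / (2 * n) := by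
    simp only [bitPosition]; ring
  rw [this, lt_add_iff_pos_right, div_pos_iff_of_pos_right (by positivity)]

theorem homDensity_bitGraph {k : ℕ} (F : SimpleGraph (Fin k)) {n : ℕ+} (π : Equiv.Perm (Fin n))
    (b : Fin n → Bool) : homDensity F (bitGraph π b) =
      (Measure.pi fun _ : Fin k => (empirical (bitPosition π b) : Measure I)).real
        (homRegion F) := by
  classical
  rw [pi_empirical_apply _ (isOpen_homRegion F).measurableSet, homDensity_eq_card]
  congr 3
  ext φ
  rw [Finset.mem_filter, Finset.mem_filter]
  simp only [bitGraph_adj_iff_bitPosition, homRegion, Set.mem_ofPred_eq, Function.comp_apply]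

/-- Weak convergence passes to finite powers, and the portmanteau theorem applies to a region with
null frontier. -/
theorem tendsto_homDensity_bitGraph {α : Type*} {l : Filter α} [l.IsCountablyGenerated]
    {N : α → ℕ+} {π : ∀ a, Equiv.Perm (Fin (N a))} {b : ∀ a, Fin (N a) → Bool}
    (hN : Tendsto N l atTop) (hb : Tendsto (fun a => discrepancy (b a)) l (𝓝 0)) {k : ℕ}
    (F : SimpleGraph (Fin k)) :
    Tendsto (fun a => homDensity F (bitGraph (π a) (b a))) l
      (𝓝 ((thresholdGraphon uniformUnitInterval uniform_isReflectionInvariant).homDensity F)) := by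
  have h1 : Tendsto (fun a => ProbabilityMeasure.pi fun _ : Fin k =>
      empirical (bitPosition (π a) (b a))) l
      (𝓝 (ProbabilityMeasure.pi fun _ : Fin k => uniformUnitInterval)) :=
    (ProbabilityMeasure.continuous_pi.tendsto _).comp
      (tendsto_pi_nhds.2 fun _ => tendsto_empirical_bitPosition hN hb)
  have h2 := ProbabilityMeasure.tendsto_measure_of_null_frontier_of_tendsto' h1
    (E := homRegion F) (volume_frontier_homRegion F)
  have h3 := (ENNReal.tendsto_toReal (measure_ne_top _ _)).comp h2
  rw [thresholdGraphon_homDensity]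
  simp only [homDensity_bitGraph]
  exact h3

theorem tendsto_toGraphSpace_bitGraph {α : Type*} {l : Filter α} [l.IsCountablyGenerated]
    {N : α → ℕ+} {π : ∀ a, Equiv.Perm (Fin (N a))} {b : ∀ a, Fin (N a) → Bool}
    (hN : Tendsto N l atTop) (hb : Tendsto (fun a => discrepancy (b a)) l (𝓝 0)) :
    Tendsto (fun a => (toUnlabeled (bitGraph (π a) (b a))).toGraphSpace) l
      (𝓝 (thresholdLimit uniformUnitInterval uniform_isReflectionInvariant)) := by
  refine Tendsto.prodMk_nhds (tendsto_pi_nhds.2 fun F => tendsto_homDensity_bitGraph hN hb F.2) ?_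
  simpa using tendsto_one_div_order hN

/-! ### Convergence in probability -/

/-- Construction sequences of all lengths. -/
abbrev BitIndex : Type := Σ n : ℕ+, Equiv.Perm (Fin n) × (Fin n → Bool)

/-- The filter of long construction sequences of small discrepancy. -/
def balancedFilter : Filter BitIndex :=
  comap Sigma.fst atTop ⊓ comap (fun a => discrepancy a.2.2) (𝓝 0)

instance : balancedFilter.IsCountablyGenerated := by
  unfold balancedFilter; infer_instance

theorem tendsto_order_balancedFilter :
    Tendsto (fun a : BitIndex => a.1) balancedFilter atTop := tendsto_comap.mono_left inf_le_left

theorem tendsto_discrepancy_balancedFilter :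
    Tendsto (fun a : BitIndex => discrepancy a.2.2) balancedFilter (𝓝 0) :=
  tendsto_comap.mono_left inf_le_right

/-- Unfolding the filter turns a deterministic limit into the form needed for counting: for large
`n`, missing `U` costs discrepancy at least `ε`. -/
theorem exists_discrepancy_of_tendsto {E : Type*} [TopologicalSpace E] {Z : BitIndex → E} {c : E}
    (hZ : Tendsto Z balancedFilter (𝓝 c)) {U : Set E} (hU : U ∈ 𝓝 c) :
    ∃ (n₀ : ℕ+) (ε : ℝ), 0 < ε ∧ ∀ n ≥ n₀, ∀ (π : Equiv.Perm (Fin n)) (b : Fin n → Bool),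
      Z ⟨n, π, b⟩ ∉ U → ε ≤ discrepancy b := by
  have h := ((atTop_basis (α := ℕ+)).comap (Sigma.fst : BitIndex → ℕ+)).inf
    ((Metric.nhds_basis_ball (x := (0 : ℝ))).comap fun a : BitIndex => discrepancy a.2.2)
  obtain ⟨⟨n₀, ε⟩, ⟨-, hε⟩, hsub⟩ := h.mem_iff.1 (hZ hU)
  refine ⟨n₀, ε, hε, fun n hn π b hb => ?_⟩
  by_contra hlt
  refine hb (hsub ⟨hn, ?_⟩)
  simpa [abs_of_nonneg (discrepancy_nonneg b)] using hlt

theorem tendstoInProbability_of_bitGraph {Ω : ℕ+ → Type*} [∀ n, MeasurableSpace (Ω n)]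
    {P : ∀ n, Measure (Ω n)} {Y : ℕ+ → Type*} [∀ n, MeasurableSpace (Y n)]
    [∀ n, Finite (Y n)] [∀ n, MeasurableSingletonClass (Y n)] {X : ∀ n, Ω n → Y n}
    (hX : ∀ n, HasLaw (X n) (uniformOn Set.univ) (P n))
    {Φ : ∀ n : ℕ+, Equiv.Perm (Fin n) → (Fin n → Bool) → Y n}
    (hΦ : ∀ (n : ℕ+) (ε : ℝ), 0 < ε → ∀ W : Set (Y n),
      (∀ π b, Φ n π b ∈ W → ε ≤ discrepancy b) →
        uniformOn Set.univ W ≤ ENNReal.ofReal (6 / (ε * √(n : ℕ))))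
    {E : Type*} [TopologicalSpace E] {c : E} (f : ∀ n, Y n → E)
    (hf : Tendsto (fun a : BitIndex => f a.1 (Φ a.1 a.2.1 a.2.2)) balancedFilter (𝓝 c)) :
    TendstoInProbability P (fun n ω => f n (X n ω)) c := by
  intro U hU
  obtain ⟨n₀, ε, hε, h⟩ := exists_discrepancy_of_tendsto hf hU
  have hlim : Tendsto (fun n : ℕ+ => ENNReal.ofReal (6 / (ε * √(n : ℕ)))) atTop (𝓝 0) := by
    rw [← ENNReal.ofReal_zero]
    refine ENNReal.tendsto_ofReal (Tendsto.div_atTop tendsto_const_nhds ?_)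
    exact (Real.tendsto_sqrt_atTop.comp (tendsto_natCast_atTop_atTop.comp
      tendsto_PNat_val_atTop_atTop)).const_mul_atTop hε
  refine tendsto_of_tendsto_of_tendsto_of_le_of_le' tendsto_const_nhds hlim
    (Eventually.of_forall fun _ => zero_le) ?_
  filter_upwards [eventually_ge_atTop n₀] with n hn
  rw [(hX n).measure_eq (p := fun y => f n y ∉ U) (Set.toFinite _).measurableSet]
  exact hΦ n ε hε _ fun π b hb => h n hn π b hb

/-- Each neighbourhood is missed with probability below 1 for some `n`, so it contains a graph; and
a last coordinate 0 is not the inverse of an order. -/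
theorem mem_graphLimits_of_tendstoInProbability {Ω : ℕ+ → Type*} [∀ n, MeasurableSpace (Ω n)]
    {P : ∀ n, Measure (Ω n)} [∀ n, IsProbabilityMeasure (P n)] {X : ∀ n, Ω n → UnlabeledGraph n}
    {c : GraphSpace} (hc : c.2 = 0)
    (h : TendstoInProbability P (fun n ω => (X n ω).toGraphSpace) c) : c ∈ graphLimits := by
  refine ⟨mem_closure_iff_nhds.2 fun U hU => ?_, ?_⟩
  · obtain ⟨n, hn⟩ := ((h U hU).eventually_lt_const one_pos).exists
    have : ∃ ω, (X n ω).toGraphSpace ∈ U := by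
      by_contra! hc
      have e : {ω | (X n ω).toGraphSpace ∉ U} = Set.univ := Set.eq_univ_of_forall hc
      rw [e, measure_univ] at hn
      exact lt_irrefl _ hn
    obtain ⟨ω, hω⟩ := this
    exact ⟨_, hω, n, X n ω, rfl⟩
  · rintro ⟨n, G, rfl⟩
    simp [UnlabeledGraph.toGraphSpace] at hc

theorem theorem6p7
    {Ω : ℕ+ → Type*} [∀ n, MeasurableSpace (Ω n)] (P : ∀ n, Measure (Ω n))
    [∀ n, IsProbabilityMeasure (P n)]
    -- `T n` is a uniform random unlabeled threshold graph of order `n`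
    (T : ∀ n : ℕ+, Ω n → UnlabeledThresholdGraph n)
    (hT : ∀ n, HasLaw (T n) (uniformOn Set.univ) (P n))
    {Ω' : ℕ+ → Type*} [∀ n, MeasurableSpace (Ω' n)] (P' : ∀ n, Measure (Ω' n))
    [∀ n, IsProbabilityMeasure (P' n)]
    -- `L n` is a uniform random labeled threshold graph of order `n`
    (L : ∀ n : ℕ+, Ω' n → LabeledThresholdGraph n)
    (hL : ∀ n, HasLaw (L n) (uniformOn Set.univ) (P' n)) :
    (TendstoInProbability P (fun n ω => (T n ω).1.degreeDistribution) uniformUnitInterval ∧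
      TendstoInProbability P' (fun n ω => degreeDistribution (L n ω).1) uniformUnitInterval) ∧
    (thresholdLimit uniformUnitInterval uniform_isReflectionInvariant ∈ graphLimits ∧
      TendstoInProbability P (fun n ω => (T n ω).1.toGraphSpace)
        (thresholdLimit uniformUnitInterval uniform_isReflectionInvariant) ∧
      TendstoInProbability P' (fun n ω => (toUnlabeled (L n ω).1).toGraphSpace)
        (thresholdLimit uniformUnitInterval uniform_isReflectionInvariant)) := by
  have hT' : TendstoInProbability P (fun n ω => (T n ω).1.toGraphSpace)
      (thresholdLimit uniformUnitInterval uniform_isReflectionInvariant) :=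
    tendstoInProbability_of_bitGraph hT
      (fun n _ hε W hW => uniformOn_unlabeled_le n.pos hε W hW) (fun _ G => G.1.toGraphSpace)
      (tendsto_toGraphSpace_bitGraph tendsto_order_balancedFilter
        tendsto_discrepancy_balancedFilter)
  refine ⟨⟨?_, ?_⟩, mem_graphLimits_of_tendstoInProbability rfl hT', hT', ?_⟩
  · exact tendstoInProbability_of_bitGraph hT
      (fun n _ hε W hW => uniformOn_unlabeled_le n.pos hε W hW)
      (fun _ G => G.1.degreeDistribution)
      (tendsto_degreeDistribution_bitGraph tendsto_order_balancedFilter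
        tendsto_discrepancy_balancedFilter)
  · exact tendstoInProbability_of_bitGraph hL
      (fun n _ hε W hW => uniformOn_labeled_le n.pos hε W hW)
      (fun _ G => degreeDistribution G.1)
      (tendsto_degreeDistribution_bitGraph tendsto_order_balancedFilter
        tendsto_discrepancy_balancedFilter)
  · exact tendstoInProbability_of_bitGraph hL
      (fun n _ hε W hW => uniformOn_labeled_le n.pos hε W hW)
      (fun _ G => (toUnlabeled G.1).toGraphSpace)
      (tendsto_toGraphSpace_bitGraph tendsto_order_balancedFilter
        tendsto_discrepancy_balancedFilter)

end
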